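/- **Proposition ($E_q(2)$ as a crossed product).** Let $k$ be a field, let $q,\mu,\nu\in k^*$ and $s\in\mathbb Z$. Let $P=E_q(2)$ be the unital associative $k$-algebra generated by $v,v^{-1},n,\bar n$ subject to $$vn=q^2nv,\quad v\bar n=q^2\bar nv,\quad n\bar n=q^2\bar nn,\quad vv^{-1}=v^{-1}v=1,$$ let $X_q$ (the quantum hyperboloid) be the unital associative $k$-algebra generated by $z,\bar z$ subject to $z\bar z=q^2\bar zz+(1-q^2)$, and let $C$ be the coalgebra with basis $c_p$, $p\in\mathbb Z$, of group-like elements ($\Delta c_p=c_p\otimes c_p$, $\epsilon(c_p)=1$). *Terminology.* An entwining structure is a linear map $\psi:C\otimes P\to P\otimes C$, written $\psi(c\otimes u)=u_\alpha\otimes c^\alpha$, such that (A) $\psi\circ(\mathrm{id}_C\otimes\mathrm{mult})=(\mathrm{mult}\otimes\mathrm{id}_C)\circ(\mathrm{id}_P\otimes\psi)\circ(\psi\otimes\mathrm{id}_P)$ and $\psi(c\otimes1)=1\otimes c$; (B) $(\mathrm{id}_P\otimes\Delta)\circ\psi=(\psi\otimes\mathrm{id}_C)\circ(\mathrm{id}_C\otimes\psi)\circ(\Delta\otimes\mathrm{id}_P)$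 and $(\mathrm{id}_P\otimes\epsilon)\circ\psi=\epsilon\otimes\mathrm{id}_P$. Entwining data $(P,C,\psi,e,\psi^C)$ consist of an entwining structure $\psi$, a group-like $e\in C$, and a linear map $\psi^C:C\otimes C\to C\otimes C$, written $\psi^C(b\otimes c)=c_A\otimes b^A$, satisfying the conditions (B) with $P$ replaced by $C$, and $\psi^C(e\otimes c)=\Delta c$. Put $M=\{x\in P:\psi(e\otimes x)=x\otimes e\}$, a subalgebra of $P$. Crossed product data are linear maps $\rho:C\otimes P\to P$ and $\sigma:C\otimes C\to M$ such that for all $a,b,c\in C$ and $x,y\in M$ (i) $\rho(e,x)=x$, $\rho(c,1)=\epsilon(c)$; (ii) $\rho(c_{(1)},x_\alpha)\otimes c_{(2)}{}^\alpha\in M\otimes C$; (iii) $\rho(c_{(1)},(xy)_\alpha)\otimes c_{(2)}{}^\alpha=\rho(c_{(1)},x_\alpha)\,\rho(c_{(2)}{}^\alpha{}_{(1)},y_\beta)\otimes c_{(2)}{}^\alpha{}_{(2)}{}^\beta$; (iv) $\sigma(e,c)=\epsilon(c)$, $\sigma(c_{(1)},e_A)\otimes c_{(2)}{}^A=1\otimes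 c$; (v) $\rho(a_{(1)},\sigma(b_{(1)},c_A)_\alpha)\,\sigma(a_{(2)}{}^\alpha{}_{(1)},b_{(2)}{}^A{}_B)\otimes a_{(2)}{}^\alpha{}_{(2)}{}^B=\sigma(a_{(1)},b_A)\,\sigma(a_{(2)}{}^A{}_{(1)},c_B)\otimes a_{(2)}{}^A{}_{(2)}{}^B$; (vi) $\rho(a_{(1)},\rho(b_{(1)},x_\alpha)_\beta)\,\sigma(a_{(2)}{}^\beta{}_{(1)},b_{(2)}{}^\alpha{}_A)\otimes a_{(2)}{}^\beta{}_{(2)}{}^A=\sigma(a_{(1)},b_A)\,\rho(a_{(2)}{}^A{}_{(1)},x_\alpha)\otimes a_{(2)}{}^A{}_{(2)}{}^\alpha$. The crossed product $M\rtimes_{\rho,\sigma}C$ is then the vector space $M\otimes C$ with the associative product $$(x\otimes b)(y\otimes c)=x\,\rho(b_{(1)},y_\alpha)\,\sigma(b_{(2)}{}^\alpha{}_{(1)},c_A)\otimes b_{(2)}{}^\alpha{}_{(2)}{}^A$$ and the unit $1\otimes e$. *Claim.* 1. There is exactly one linear map $\psi:C\otimes P\to P\otimes C$ satisfying (A) and,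 for all $p\in\mathbb Z$, $$\psi(c_p\otimes v)=v\otimes c_{p+1},\qquad\psi(c_p\otimes n)=n\otimes c_p+\mu q^{2p}v\otimes c_p-\mu q^{2p}v\otimes c_{p+1},$$ $$\psi(c_p\otimes v^{-1})=v^{-1}\otimes c_{p-1},\qquad\psi(c_p\otimes\bar n)=\bar n\otimes c_p+\nu q^{2p}v^{-1}\otimes c_p-\nu q^{2p}v^{-1}\otimes c_{p-1}.$$ It also satisfies (B), and together with $e=c_s$ and $\psi^C(c_p\otimes c_r)=c_r\otimes c_{p+r-s}$ it gives entwining data. 2. There is an algebra isomorphism $X_q\cong M$ with $z\mapsto v+\mu^{-1}q^{-2s}n$ and $\bar z\mapsto v^{-1}+\nu^{-1}q^{-2s}\bar n$. 3. The linear map $\Phi:C\to P$, $\Phi(c_p)=v^{p-s}$, satisfies $\Phi(e)=1$, is invertible for the convolution product $(f*g)(c)=f(c_{(1)})g(c_{(2)})$, and is covariant: $\psi\circ(\mathrm{id}_C\otimes\Phi)=(\Phi\otimes\mathrm{id}_C)\circ\psi^C$. 4. The formulas $\rho(c,u)=\Phi(c_{(1)})u_\alpha\Phi^{-1}(c_{(2)}{}^\alpha)$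 and $\sigma(b,c)=\Phi(b_{(1)})\Phi(c_A)\Phi^{-1}(b_{(2)}{}^A)$, where $\Phi^{-1}$ is the convolution inverse, define crossed product data ($\sigma$ takes values in $M$). Here $\sigma(c_p,c_r)=1$ for all $p,r\in\mathbb Z$, and for all $p\in\mathbb Z$ $$\rho(c_p,v^{\pm1})=1,\quad\rho(c_p,n)=q^{2p}\bigl(q^{-2s}n+\mu(v-1)\bigr),\quad\rho(c_p,\bar n)=q^{2p}\bigl(q^{-2s}\bar n+\nu(v^{-1}-1)\bigr).$$ 5. Writing $X_q\rtimes_\Phi C$ for $M\rtimes_{\rho,\sigma}C$, with $M$ identified with $X_q$ by part 2, the map $x\otimes c\mapsto x\,\Phi(c)$ is an isomorphism of algebras $X_q\rtimes_\Phi C\cong E_q(2)$. -/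

import Mathlib

open scoped TensorProduct

noncomputable section

namespace CoalgCrossed

section General

variable {k : Type*} [Field k]
variable {C : Type*} [AddCommGroup C] [Module k C]
variable {P : Type*} [Ring P] [Algebra k P]
variable {Q : Type*} [AddCommGroup Q] [Module k Q]

/-- For `f : C ⊗ Q → P ⊗ C`, the map `(P ⊗ C) ⊗ Q → P ⊗ C`, `(p ⊗ c) ⊗ u ↦ p · f (c ⊗ u)`,
that is `(μ ⊗ id_C) ∘ (id_P ⊗ f)`. -/
def mulExt (f : C ⊗[k] Q →ₗ[k] P ⊗[k] C) : (P ⊗[k] C) ⊗[k] Q →ₗ[k] P ⊗[k] C :=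
  (LinearMap.mul' k P).rTensor C ∘ₗ (TensorProduct.assoc k P P C).symm.toLinearMap ∘ₗ
    f.lTensor P ∘ₗ (TensorProduct.assoc k P C Q).toLinearMap

/-- For `f : C ⊗ Q → P` and `φ : C ⊗ Q → Q ⊗ C`, `φ (c ⊗ u) = u_α ⊗ c^α`, the map
`C ⊗ Q → P ⊗ C`, `c ⊗ u ↦ f (c₁ ⊗ u_α) ⊗ c₂^α`. -/
def hat [Coalgebra k C] (φ : C ⊗[k] Q →ₗ[k] Q ⊗[k] C) (f : C ⊗[k] Q →ₗ[k] P) :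
    C ⊗[k] Q →ₗ[k] P ⊗[k] C :=
  f.rTensor C ∘ₗ (TensorProduct.assoc k C Q C).symm.toLinearMap ∘ₗ
    φ.lTensor C ∘ₗ (TensorProduct.assoc k C C Q).toLinearMap ∘ₗ
      (Coalgebra.comul (R := k) (A := C)).rTensor Q

/-- `ψ : C ⊗ P → P ⊗ C` is compatible with the algebra structure of `P`:
`ψ ∘ (id_C ⊗ μ) = (μ ⊗ id_C) ∘ ψ₂₃ ∘ ψ₁₂` and `ψ (c ⊗ 1) = 1 ⊗ c`. -/
structure CompatibleAlg (ψ : C ⊗[k] P →ₗ[k] P ⊗[k] C) : Prop where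
  mul : ψ ∘ₗ (LinearMap.mul' k P).lTensor C =
    mulExt ψ ∘ₗ ψ.rTensor P ∘ₗ (TensorProduct.assoc k C P P).symm.toLinearMap
  one : ∀ c : C, ψ (c ⊗ₜ 1) = 1 ⊗ₜ c

/-- `φ : C ⊗ Q → Q ⊗ C` is compatible with the coalgebra structure of `C`:
`(id_Q ⊗ Δ) ∘ φ = φ₁₂ ∘ φ₂₃ ∘ (Δ ⊗ id_Q)` and `(id_Q ⊗ ε) ∘ φ = ε ⊗ id_Q`. -/
structure CompatibleCoalg [Coalgebra k C] (φ : C ⊗[k] Q →ₗ[k] Q ⊗[k] C) : Prop where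
  comul : (Coalgebra.comul (R := k) (A := C)).lTensor Q ∘ₗ φ =
    (TensorProduct.assoc k Q C C).toLinearMap ∘ₗ φ.rTensor C ∘ₗ
      (TensorProduct.assoc k C Q C).symm.toLinearMap ∘ₗ φ.lTensor C ∘ₗ
        (TensorProduct.assoc k C C Q).toLinearMap ∘ₗ
          (Coalgebra.comul (R := k) (A := C)).rTensor Q
  counit : (TensorProduct.rid k Q).toLinearMap ∘ₗ
      (Coalgebra.counit (R := k) (A := C)).lTensor Q ∘ₗ φ =
    (TensorProduct.lid k Q).toLinearMap ∘ₗ (Coalgebra.counit (R := k) (A := C)).rTensor Q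

end General

/-- Entwining data `(P, C, ψ, e, ψ^C)`: an entwining structure `ψ` between the coalgebra `C` and
the algebra `P`, a group-like `e ∈ C`, and a map `ψ^C : C ⊗ C → C ⊗ C` compatible with the
coalgebra structure and satisfying `ψ^C (e ⊗ c) = Δ c`. -/
structure EntwiningData (k C P : Type*) [Field k] [AddCommGroup C] [Module k C] [Coalgebra k C]
    [Ring P] [Algebra k P] where
  ψ : C ⊗[k] P →ₗ[k] P ⊗[k] C
  ψ_alg : CompatibleAlg ψ
  ψ_coalg : CompatibleCoalg ψ
  e : C
  e_groupLike : IsGroupLikeElem k e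
  ψC : C ⊗[k] C →ₗ[k] C ⊗[k] C
  ψC_coalg : CompatibleCoalg ψC
  ψC_e : ∀ c : C, ψC (e ⊗ₜ c) = Coalgebra.comul (R := k) c

section Lemmas

variable {k : Type*} [Field k]
variable {C : Type*} [AddCommGroup C] [Module k C]
variable {P : Type*} [Ring P] [Algebra k P]
variable {Q : Type*} [AddCommGroup Q] [Module k Q]

theorem mulExt_tmul (f : C ⊗[k] Q →ₗ[k] P ⊗[k] C) (p : P) (c : C) (u : Q) :
    mulExt f ((p ⊗ₜ c) ⊗ₜ u) = p • f (c ⊗ₜ u) := by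
  simp only [mulExt, LinearMap.comp_apply, LinearEquiv.coe_coe, TensorProduct.assoc_tmul,
    LinearMap.lTensor_tmul]
  induction f (c ⊗ₜ[k] u) with
  | zero => simp
  | tmul a b => simp [TensorProduct.smul_tmul']
  | add a b ha hb => simp only [TensorProduct.tmul_add, map_add, smul_add, ha, hb]

theorem mulExt_smul (f : C ⊗[k] Q →ₗ[k] P ⊗[k] C) (p : P) (t : P ⊗[k] C) (u : Q) :
    mulExt f ((p • t) ⊗ₜ u) = p • mulExt f (t ⊗ₜ u) := by
  induction t with
  | zero => simp
  | tmul a b => simp [TensorProduct.smul_tmul', mulExt_tmul, mul_smul]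
  | add a b ha hb => simp only [smul_add, TensorProduct.add_tmul, map_add, ha, hb]

end Lemmas

namespace EntwiningData

variable {k C P : Type*} [Field k] [AddCommGroup C] [Module k C] [Coalgebra k C]
  [Ring P] [Algebra k P]

theorem ψ_mul (D : EntwiningData k C P) (c : C) (u w : P) :
    D.ψ (c ⊗ₜ (u * w)) = mulExt D.ψ (D.ψ (c ⊗ₜ u) ⊗ₜ w) := by
  simpa using LinearMap.congr_fun D.ψ_alg.mul (c ⊗ₜ[k] (u ⊗ₜ[k] w))

/-- The fixed point subalgebra `M = {x ∈ P | Δ_R x = x ⊗ e}`, where `Δ_R u = ψ (e ⊗ u)`. -/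
def M (D : EntwiningData k C P) : Subalgebra k P where
  carrier := {x | D.ψ (D.e ⊗ₜ x) = x ⊗ₜ D.e}
  mul_mem' := by
    intro a b ha hb
    simp only [Set.mem_ofPred_eq] at ha hb ⊢
    rw [ψ_mul, ha, mulExt_tmul, hb, TensorProduct.smul_tmul', smul_eq_mul]
  add_mem' := by
    intro a b ha hb
    simp only [Set.mem_ofPred_eq] at ha hb ⊢
    rw [TensorProduct.tmul_add, map_add, ha, hb, TensorProduct.add_tmul]
  algebraMap_mem' := by
    intro r
    simp only [Set.mem_ofPred_eq, Algebra.algebraMap_eq_smul_one]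
    rw [TensorProduct.tmul_smul, map_smul, D.ψ_alg.one, TensorProduct.smul_tmul']

/-- The inclusion `M ⊗ C → P ⊗ C`. -/
def incl (D : EntwiningData k C P) : D.M ⊗[k] C →ₗ[k] P ⊗[k] C :=
  D.M.val.toLinearMap.rTensor C

theorem incl_tmul (D : EntwiningData k C P) (x : D.M) (c : C) :
    D.incl (x ⊗ₜ c) = (x : P) ⊗ₜ c := rfl

theorem incl_injective (D : EntwiningData k C P) : Function.Injective D.incl :=
  Module.Flat.rTensor_preserves_injective_linearMap _ Subtype.val_injective

/-- `ρ̂ (c ⊗ u) = ρ (c₁, u_α) ⊗ c₂^α`. -/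
def rhoHat (D : EntwiningData k C P) (ρ : C ⊗[k] P →ₗ[k] P) : C ⊗[k] P →ₗ[k] P ⊗[k] C :=
  hat D.ψ ρ

/-- `σ̂ (b ⊗ c) = σ (b₁, c_A) ⊗ b₂^A`, with values in `M ⊗ C ⊆ P ⊗ C`. -/
def sigmaHat (D : EntwiningData k C P) (σ : C ⊗[k] C →ₗ[k] D.M) : C ⊗[k] C →ₗ[k] P ⊗[k] C :=
  hat D.ψC (D.M.val.toLinearMap ∘ₗ σ)

/-- The formula for the product,
`(x ⊗ b)(y ⊗ c) = x ρ (b₁, y_α) σ (b₂^α₁, c_A) ⊗ b₂^α₂^A`, on all of `P ⊗ C`. -/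
def mulFormula (D : EntwiningData k C P) (ρ : C ⊗[k] P →ₗ[k] P) (σ : C ⊗[k] C →ₗ[k] D.M) :
    (P ⊗[k] C) ⊗[k] (P ⊗[k] C) →ₗ[k] P ⊗[k] C :=
  mulExt (D.sigmaHat σ) ∘ₗ (mulExt (D.rhoHat ρ)).rTensor C ∘ₗ
    (TensorProduct.assoc k (P ⊗[k] C) P C).symm.toLinearMap

/-- `(ρ, σ)` are crossed product data for the given entwining data. -/
structure IsCrossedProductData (D : EntwiningData k C P) (ρ : C ⊗[k] P →ₗ[k] P)
    (σ : C ⊗[k] C →ₗ[k] D.M) : Prop where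
  /-- `ρ (e, x) = x` for `x ∈ M` -/
  rho_e : ∀ x ∈ D.M, ρ (D.e ⊗ₜ x) = x
  /-- `ρ (c, 1) = ε (c)` -/
  rho_one : ∀ c : C, ρ (c ⊗ₜ 1) = algebraMap k P (Coalgebra.counit (R := k) c)
  /-- `ρ (c₁, x_α) ⊗ c₂^α ∈ M ⊗ C` for `x ∈ M` -/
  rho_mem : ∀ (c : C), ∀ x ∈ D.M, D.rhoHat ρ (c ⊗ₜ x) ∈ LinearMap.range D.incl
  /-- `ρ (c₁, (xy)_α) ⊗ c₂^α = ρ (c₁, x_α) ρ (c₂^α₁, y_β) ⊗ c₂^α₂^β` for `x, y ∈ M` -/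
  rho_mul : ∀ (c : C), ∀ x ∈ D.M, ∀ y ∈ D.M,
    D.rhoHat ρ (c ⊗ₜ (x * y)) = mulExt (D.rhoHat ρ) (D.rhoHat ρ (c ⊗ₜ x) ⊗ₜ y)
  /-- `σ (e, c) = ε (c)` -/
  sigma_e : ∀ c : C, σ (D.e ⊗ₜ c) = algebraMap k D.M (Coalgebra.counit (R := k) c)
  /-- `σ (c₁, e_A) ⊗ c₂^A = 1 ⊗ c` -/
  sigma_hat_e : ∀ c : C, D.sigmaHat σ (c ⊗ₜ D.e) = 1 ⊗ₜ c
  /-- The cocycle condition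
  `ρ (a₁, σ (b₁, c_A)_α) σ (a₂^α₁, b₂^A_B) ⊗ a₂^α₂^B = σ (a₁, b_A) σ (a₂^A₁, c_B) ⊗ a₂^A₂^B`. -/
  cocycle : ∀ a b c : C,
    mulExt (D.sigmaHat σ) ((D.rhoHat ρ).rTensor C
        ((TensorProduct.assoc k C P C).symm (a ⊗ₜ D.sigmaHat σ (b ⊗ₜ c)))) =
      mulExt (D.sigmaHat σ) (D.sigmaHat σ (a ⊗ₜ b) ⊗ₜ c)
  /-- The twisted module condition
  `ρ (a₁, ρ (b₁, x_α)_β) σ (a₂^β₁, b₂^α_A) ⊗ a₂^β₂^A = σ (a₁, b_A) ρ (a₂^A₁, x_α) ⊗ a₂^A₂^α`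
  for `x ∈ M`. -/
  twisted_module : ∀ a b : C, ∀ x ∈ D.M,
    mulExt (D.sigmaHat σ) ((D.rhoHat ρ).rTensor C
        ((TensorProduct.assoc k C P C).symm (a ⊗ₜ D.rhoHat ρ (b ⊗ₜ x)))) =
      mulExt (D.rhoHat ρ) (D.sigmaHat σ (a ⊗ₜ b) ⊗ₜ x)

section Product

variable {D : EntwiningData k C P} {ρ : C ⊗[k] P →ₗ[k] P} {σ : C ⊗[k] C →ₗ[k] D.M}

theorem mulFormula_tmul (t : P ⊗[k] C) (w : P) (c : C) :
    D.mulFormula ρ σ (t ⊗ₜ (w ⊗ₜ c)) =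
      mulExt (D.sigmaHat σ) (mulExt (D.rhoHat ρ) (t ⊗ₜ w) ⊗ₜ c) := by
  simp [mulFormula]

theorem mulFormula_smul (p : P) (t s : P ⊗[k] C) :
    D.mulFormula ρ σ ((p • t) ⊗ₜ s) = p • D.mulFormula ρ σ (t ⊗ₜ s) := by
  induction s with
  | zero => simp
  | tmul a b => simp only [mulFormula_tmul, mulExt_smul]
  | add a b ha hb => simp only [smul_add, TensorProduct.tmul_add, map_add, ha, hb]

theorem mulFormula_one_tmul (a : C) (s : P ⊗[k] C) :
    D.mulFormula ρ σ ((1 ⊗ₜ a) ⊗ₜ s) =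
      mulExt (D.sigmaHat σ) ((D.rhoHat ρ).rTensor C
        ((TensorProduct.assoc k C P C).symm (a ⊗ₜ s))) := by
  induction s with
  | zero => simp
  | tmul x b => simp [mulFormula_tmul, mulExt_tmul]
  | add x b hx hb => simp only [TensorProduct.tmul_add, map_add, hx, hb]

theorem smul_mem_range {x : P} (hx : x ∈ D.M) {t : P ⊗[k] C}
    (ht : t ∈ LinearMap.range D.incl) : x • t ∈ LinearMap.range D.incl := by
  obtain ⟨w, rfl⟩ := ht
  induction w with
  | zero => simp
  | tmul a b =>
    refine ⟨(⟨x, hx⟩ * a) ⊗ₜ b, ?_⟩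
    simp [incl_tmul, TensorProduct.smul_tmul']
  | add a b ha hb =>
    rw [map_add, smul_add]
    exact add_mem ha hb

theorem sigmaHat_mem (b c : C) : D.sigmaHat σ (b ⊗ₜ c) ∈ LinearMap.range D.incl := by
  simp only [sigmaHat, hat, LinearMap.rTensor_comp, LinearMap.comp_apply]
  exact ⟨_, rfl⟩

theorem mulExt_sigmaHat_mem {t : P ⊗[k] C} (ht : t ∈ LinearMap.range D.incl) (c : C) :
    mulExt (D.sigmaHat σ) (t ⊗ₜ c) ∈ LinearMap.range D.incl := by
  obtain ⟨w, rfl⟩ := ht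
  induction w with
  | zero => simp
  | tmul a b =>
    rw [incl_tmul, mulExt_tmul]
    exact smul_mem_range a.2 (sigmaHat_mem b c)
  | add a b ha hb =>
    rw [map_add, TensorProduct.add_tmul, map_add]
    exact add_mem ha hb

theorem IsCrossedProductData.mul_mem (h : D.IsCrossedProductData ρ σ)
    (t : (D.M ⊗[k] C) ⊗[k] (D.M ⊗[k] C)) :
    (D.mulFormula ρ σ ∘ₗ TensorProduct.map D.incl D.incl) t ∈ LinearMap.range D.incl := by
  induction t with
  | zero => simp
  | add a b ha hb => rw [map_add]; exact add_mem ha hb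
  | tmul t s =>
    simp only [LinearMap.comp_apply, TensorProduct.map_tmul]
    induction s with
    | zero => simp
    | add a b ha hb => rw [map_add, TensorProduct.tmul_add, map_add]; exact add_mem ha hb
    | tmul y c =>
      rw [incl_tmul, mulFormula_tmul]
      apply mulExt_sigmaHat_mem
      induction t with
      | zero => simp
      | add a b ha hb => rw [map_add, TensorProduct.add_tmul, map_add]; exact add_mem ha hb
      | tmul x b =>
        rw [incl_tmul, mulExt_tmul]
        exact smul_mem_range x.2 (h.rho_mem b y y.2)

/-- The product on `M ⊗ C`: the restriction of `mulFormula`. -/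
def crossedMul (h : D.IsCrossedProductData ρ σ) :
    (D.M ⊗[k] C) ⊗[k] (D.M ⊗[k] C) →ₗ[k] D.M ⊗[k] C :=
  (LinearEquiv.ofInjective D.incl D.incl_injective).symm.toLinearMap ∘ₗ
    LinearMap.codRestrict (LinearMap.range D.incl)
      (D.mulFormula ρ σ ∘ₗ TensorProduct.map D.incl D.incl) h.mul_mem

theorem incl_crossedMul (h : D.IsCrossedProductData ρ σ) (t s : D.M ⊗[k] C) :
    D.incl (crossedMul h (t ⊗ₜ s)) = D.mulFormula ρ σ (D.incl t ⊗ₜ D.incl s) := by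
  have : ∀ r : LinearMap.range D.incl,
      D.incl ((LinearEquiv.ofInjective D.incl D.incl_injective).symm r) = r := fun r => by
    rw [← LinearEquiv.ofInjective_apply (h := D.incl_injective), LinearEquiv.apply_symm_apply]
  simp [crossedMul, this]

namespace IsCrossedProductData

theorem mulFormula_rhoHat (h : D.IsCrossedProductData ρ σ)
    (t : P ⊗[k] C) (b : C) (x : P) (hx : x ∈ D.M) :
    D.mulFormula ρ σ (t ⊗ₜ D.rhoHat ρ (b ⊗ₜ x)) =
      mulExt (D.rhoHat ρ) (mulExt (D.sigmaHat σ) (t ⊗ₜ b) ⊗ₜ x) := by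
  induction t with
  | zero => simp
  | add a b ha hb => simp only [TensorProduct.add_tmul, map_add, ha, hb]
  | tmul p a =>
    have : p ⊗ₜ[k] a = p • (1 ⊗ₜ[k] a : P ⊗[k] C) := by simp [TensorProduct.smul_tmul']
    rw [mulExt_tmul, mulExt_smul, this, mulFormula_smul, mulFormula_one_tmul, h.twisted_module a b x hx]

theorem mulFormula_sigmaHat (h : D.IsCrossedProductData ρ σ) (t : P ⊗[k] C) (b c : C) :
    D.mulFormula ρ σ (t ⊗ₜ D.sigmaHat σ (b ⊗ₜ c)) =
      mulExt (D.sigmaHat σ) (mulExt (D.sigmaHat σ) (t ⊗ₜ b) ⊗ₜ c) := by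
  induction t with
  | zero => simp
  | add a b ha hb => simp only [TensorProduct.add_tmul, map_add, ha, hb]
  | tmul p a =>
    have : p ⊗ₜ[k] a = p • (1 ⊗ₜ[k] a : P ⊗[k] C) := by simp [TensorProduct.smul_tmul']
    rw [mulExt_tmul, mulExt_smul, this, mulFormula_smul, mulFormula_one_tmul, h.cocycle a b c]

theorem mulExt_rhoHat_mul (h : D.IsCrossedProductData ρ σ)
    (t : P ⊗[k] C) (x y : P) (hx : x ∈ D.M) (hy : y ∈ D.M) :
    mulExt (D.rhoHat ρ) (t ⊗ₜ (x * y)) = mulExt (D.rhoHat ρ) (mulExt (D.rhoHat ρ) (t ⊗ₜ x) ⊗ₜ y) := by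
  induction t with
  | zero => simp
  | add a b ha hb => simp only [TensorProduct.add_tmul, map_add, ha, hb]
  | tmul p a => rw [mulExt_tmul, mulExt_tmul, mulExt_smul, h.rho_mul a x hx y hy]

theorem mulFormula_smul_right (h : D.IsCrossedProductData ρ σ)
    (t : P ⊗[k] C) (u : P) (hu : u ∈ D.M) (s : P ⊗[k] C)
    (hs : s ∈ LinearMap.range D.incl) :
    D.mulFormula ρ σ (t ⊗ₜ (u • s)) = D.mulFormula ρ σ (mulExt (D.rhoHat ρ) (t ⊗ₜ u) ⊗ₜ s) := by
  obtain ⟨w, rfl⟩ := hs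
  induction w with
  | zero => simp
  | add a b ha hb => simp only [smul_add, TensorProduct.tmul_add, map_add, ha, hb]
  | tmul m c =>
    rw [incl_tmul, TensorProduct.smul_tmul', smul_eq_mul, mulFormula_tmul, mulFormula_tmul,
      h.mulExt_rhoHat_mul t u m hu m.2]

theorem mulFormula_ext (h : D.IsCrossedProductData ρ σ)
    (t : P ⊗[k] C) (y : P) (hy : y ∈ D.M) (c : C) (w : P ⊗[k] C)
    (hw : w ∈ LinearMap.range D.incl) :
    D.mulFormula ρ σ (t ⊗ₜ (y • mulExt (D.sigmaHat σ) (w ⊗ₜ c))) =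
      mulExt (D.sigmaHat σ) (D.mulFormula ρ σ (mulExt (D.rhoHat ρ) (t ⊗ₜ y) ⊗ₜ w) ⊗ₜ c) := by
  obtain ⟨w, rfl⟩ := hw
  induction w with
  | zero => simp
  | add a b ha hb =>
    simp only [smul_add, TensorProduct.tmul_add, TensorProduct.add_tmul, map_add, ha, hb]
  | tmul m b =>
    rw [incl_tmul, mulExt_tmul, smul_smul,
      h.mulFormula_smul_right t (y * m) (D.M.mul_mem hy m.2) _ (sigmaHat_mem b c),
      h.mulFormula_sigmaHat, h.mulExt_rhoHat_mul t y m hy m.2, mulFormula_tmul]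

theorem crossedMul_assoc (h : D.IsCrossedProductData ρ σ) (r s t : D.M ⊗[k] C) :
    crossedMul h (crossedMul h (r ⊗ₜ s) ⊗ₜ t) = crossedMul h (r ⊗ₜ crossedMul h (s ⊗ₜ t)) := by
  apply D.incl_injective
  simp only [incl_crossedMul]
  generalize D.incl r = r
  induction t with
  | zero => simp
  | add a b ha hb => simp only [TensorProduct.tmul_add, map_add, ha, hb]
  | tmul z c =>
    induction s with
    | zero => simp
    | add a b ha hb =>
      simp only [TensorProduct.tmul_add, TensorProduct.add_tmul, map_add, ha, hb]
    | tmul y b =>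
      rw [incl_tmul, incl_tmul, mulFormula_tmul, mulFormula_tmul, mulFormula_tmul, mulExt_tmul,
        mulExt_smul, h.mulFormula_ext r y y.2 c _ (h.rho_mem b z z.2),
        h.mulFormula_rhoHat _ b z z.2]

theorem crossedMul_one_left (h : D.IsCrossedProductData ρ σ)
    (t : D.M ⊗[k] C) : crossedMul h ((1 ⊗ₜ D.e) ⊗ₜ t) = t := by
  apply D.incl_injective
  rw [incl_crossedMul]
  induction t with
  | zero => simp
  | add a b ha hb => simp only [TensorProduct.tmul_add, map_add, ha, hb]
  | tmul y c =>
    have h1 : D.rhoHat ρ (D.e ⊗ₜ (y : P)) = (y : P) ⊗ₜ D.e := by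
      have : D.ψ (D.e ⊗ₜ (y : P)) = (y : P) ⊗ₜ D.e := y.2
      simp [rhoHat, hat, D.e_groupLike.comul_eq_tmul_self, this, h.rho_e y y.2]
    have h2 : D.sigmaHat σ (D.e ⊗ₜ c) = 1 ⊗ₜ c := by
      simp only [sigmaHat, hat, LinearMap.comp_apply, LinearEquiv.coe_coe,
        LinearMap.rTensor_tmul, D.e_groupLike.comul_eq_tmul_self, TensorProduct.assoc_tmul,
        LinearMap.lTensor_tmul, D.ψC_e]
      have h3 := Coalgebra.rTensor_counit_comul (R := k) c
      have : ∀ s : C ⊗[k] C,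
          (D.M.val.toLinearMap ∘ₗ σ).rTensor C
              ((TensorProduct.assoc k C C C).symm (D.e ⊗ₜ s)) =
            (Algebra.linearMap k P).rTensor C
              ((Coalgebra.counit (R := k) (A := C)).rTensor C s) := by
        intro s
        induction s with
        | zero => simp
        | add a b ha hb => simp only [TensorProduct.tmul_add, map_add, ha, hb]
        | tmul a b => simp [h.sigma_e]
      rw [this, h3]
      simp
    rw [incl_tmul, incl_tmul, mulFormula_tmul, mulExt_tmul, h1]
    simp [mulExt_tmul, h2, TensorProduct.smul_tmul']

theorem crossedMul_one_right (h : D.IsCrossedProductData ρ σ)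
    (t : D.M ⊗[k] C) : crossedMul h (t ⊗ₜ (1 ⊗ₜ D.e)) = t := by
  apply D.incl_injective
  rw [incl_crossedMul]
  induction t with
  | zero => simp
  | add a b ha hb => simp only [TensorProduct.add_tmul, map_add, ha, hb]
  | tmul y c =>
    have h1 : D.rhoHat ρ (c ⊗ₜ (1 : P)) = 1 ⊗ₜ c := by
      simp only [rhoHat, hat, LinearMap.comp_apply, LinearEquiv.coe_coe, LinearMap.rTensor_tmul]
      have h3 := Coalgebra.rTensor_counit_comul (R := k) c
      have : ∀ s : C ⊗[k] C,
          ρ.rTensor C ((TensorProduct.assoc k C P C).symm (D.ψ.lTensor C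
              (TensorProduct.assoc k C C P (s ⊗ₜ 1)))) =
            (Algebra.linearMap k P).rTensor C
              ((Coalgebra.counit (R := k) (A := C)).rTensor C s) := by
        intro s
        induction s with
        | zero => simp
        | add a b ha hb => simp only [TensorProduct.add_tmul, map_add, ha, hb]
        | tmul a b => simp [h.rho_one, D.ψ_alg.one]
      rw [this, h3]
      simp
    rw [incl_tmul, incl_tmul, mulFormula_tmul, mulExt_tmul, OneMemClass.coe_one, h1, mulExt_smul,
      mulExt_tmul, h.sigma_hat_e]
    simp [TensorProduct.smul_tmul']

end IsCrossedProductData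

/-- The crossed product `M ⋊_{ρ,σ} C`: the vector space `M ⊗ C` with the product
`(x ⊗ b)(y ⊗ c) = x ρ (b₁, y_α) σ (b₂^α₁, c_A) ⊗ b₂^α₂^A` and the unit `1 ⊗ e`. -/
def CrossedProduct {D : EntwiningData k C P} {ρ : C ⊗[k] P →ₗ[k] P} {σ : C ⊗[k] C →ₗ[k] D.M}
    (_h : D.IsCrossedProductData ρ σ) : Type _ :=
  D.M ⊗[k] C

namespace CrossedProduct

variable (h : D.IsCrossedProductData ρ σ)

instance : AddCommGroup (CrossedProduct h) := inferInstanceAs (AddCommGroup (D.M ⊗[k] C))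

instance : Module k (CrossedProduct h) := inferInstanceAs (Module k (D.M ⊗[k] C))

/-- The identification of the vector space `M ⊗ C` with the crossed product. -/
def of : D.M ⊗[k] C ≃ₗ[k] CrossedProduct h := LinearEquiv.refl k _

instance : Ring (CrossedProduct h) :=
  { (inferInstance : AddCommGroup (CrossedProduct h)) with
    mul := fun s t => of h (crossedMul h ((of h).symm s ⊗ₜ (of h).symm t))
    one := of h (1 ⊗ₜ D.e)
    mul_assoc := fun r s t => h.crossedMul_assoc r s t
    one_mul := fun t => h.crossedMul_one_left t
    mul_one := fun t => h.crossedMul_one_right t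
    zero_mul := fun t => by
      change crossedMul h (0 ⊗ₜ _) = 0
      simp
    mul_zero := fun t => by
      change crossedMul h (_ ⊗ₜ 0) = 0
      simp
    left_distrib := fun r s t => by
      exact (congrArg (crossedMul h) (TensorProduct.tmul_add ((of h).symm r) ((of h).symm s)
        ((of h).symm t))).trans (map_add _ _ _)
    right_distrib := fun r s t => by
      exact (congrArg (crossedMul h) (TensorProduct.add_tmul ((of h).symm r) ((of h).symm s)
        ((of h).symm t))).trans (map_add _ _ _) }

instance : Algebra k (CrossedProduct h) :=
  Algebra.ofModule
    (fun r s t => by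
      change crossedMul h ((r • (of h).symm s) ⊗ₜ (of h).symm t) = r • crossedMul h _
      rw [← TensorProduct.smul_tmul', map_smul])
    (fun r s t => by
      change crossedMul h ((of h).symm s ⊗ₜ (r • (of h).symm t)) = r • crossedMul h _
      rw [TensorProduct.tmul_smul, map_smul])

theorem of_mul_of (s t : D.M ⊗[k] C) :
    of h s * of h t = of h (crossedMul h (s ⊗ₜ t)) := rfl

theorem one_eq : (1 : CrossedProduct h) = of h (1 ⊗ₜ D.e) := rfl

end CrossedProduct

end Product

section Cleft

/-- `Φ : C → P` is covariant: `ψ ∘ (id_C ⊗ Φ) = (Φ ⊗ id_C) ∘ ψ^C`. -/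
def IsCovariant (D : EntwiningData k C P) (Φ : C →ₗ[k] P) : Prop :=
  D.ψ ∘ₗ Φ.lTensor C = Φ.rTensor C ∘ₗ D.ψC

/-- For `Φ, Φ' : C → P` and `φ : C ⊗ P → P ⊗ C`, the map
`c ⊗ u ↦ Φ (c₁) u_α Φ' (c₂^α)`; applied to `Φ' = Φ⁻¹` it is the map `ρ` of the cleft extension. -/
def cleftRho (D : EntwiningData k C P) (Φ Φ' : C →ₗ[k] P) : C ⊗[k] P →ₗ[k] P :=
  LinearMap.mul' k P ∘ₗ
    TensorProduct.map Φ (LinearMap.mul' k P ∘ₗ Φ'.lTensor P ∘ₗ D.ψ) ∘ₗ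
      (TensorProduct.assoc k C C P).toLinearMap ∘ₗ
        (Coalgebra.comul (R := k) (A := C)).rTensor P

/-- The map `b ⊗ c ↦ Φ (b₁) Φ (c_A) Φ' (b₂^A)`; applied to `Φ' = Φ⁻¹` it is the map `σ` of the
cleft extension. -/
def cleftSigma (D : EntwiningData k C P) (Φ Φ' : C →ₗ[k] P) : C ⊗[k] C →ₗ[k] P :=
  LinearMap.mul' k P ∘ₗ
    TensorProduct.map Φ (LinearMap.mul' k P ∘ₗ TensorProduct.map Φ Φ' ∘ₗ D.ψC) ∘ₗ
      (TensorProduct.assoc k C C C).toLinearMap ∘ₗ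
        (Coalgebra.comul (R := k) (A := C)).rTensor C

end Cleft

end EntwiningData

section Euclidean

/-- The generators `v, v⁻¹, n, n̄` of `E_q(2)`. -/
inductive EGen : Type
  | v | vinv | n | nbar

/-- The defining relations of `E_q(2)`. -/
inductive ERel {k : Type*} [Field k] (q : k) : FreeAlgebra k EGen → FreeAlgebra k EGen → Prop
  | v_n : ERel q (.ι k .v * .ι k .n) (q ^ 2 • (.ι k .n * .ι k .v))
  | v_nbar : ERel q (.ι k .v * .ι k .nbar) (q ^ 2 • (.ι k .nbar * .ι k .v))
  | n_nbar : ERel q (.ι k .n * .ι k .nbar) (q ^ 2 • (.ι k .nbar * .ι k .n))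
  | v_vinv : ERel q (.ι k .v * .ι k .vinv) 1
  | vinv_v : ERel q (.ι k .vinv * .ι k .v) 1

/-- The two-dimensional quantum Euclidean group `E_q(2)`. -/
abbrev E {k : Type*} [Field k] (q : k) : Type _ := RingQuot (ERel q)

/-- The generators of the quantum hyperboloid. -/
inductive XGen : Type
  | z | zbar

/-- The defining relation `z z̄ = q² z̄ z + (1 - q²)` of the quantum hyperboloid. -/
inductive XRel {k : Type*} [Field k] (q : k) : FreeAlgebra k XGen → FreeAlgebra k XGen → Prop
  | z_zbar : XRel q (.ι k .z * .ι k .zbar)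
      (q ^ 2 • (.ι k .zbar * .ι k .z) + algebraMap k _ (1 - q ^ 2))

/-- The quantum hyperboloid `X_q`. -/
abbrev X {k : Type*} [Field k] (q : k) : Type _ := RingQuot (XRel q)

variable {k : Type*} [Field k]

/-- A generator of `E_q(2)`. -/
def E.gen (q : k) (g : EGen) : E q := RingQuot.mkAlgHom k (ERel q) (FreeAlgebra.ι k g)

/-- A generator of `X_q`. -/
def X.gen (q : k) (g : XGen) : X q := RingQuot.mkAlgHom k (XRel q) (FreeAlgebra.ι k g)

/-- `v` as an invertible element of `E_q(2)`, with inverse the generator `v⁻¹`. -/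
def E.vUnit (q : k) : (E q)ˣ where
  val := E.gen q .v
  inv := E.gen q .vinv
  val_inv := by
    simpa [E.gen] using RingQuot.mkAlgHom_rel k (ERel.v_vinv (q := q))
  inv_val := by
    simpa [E.gen] using RingQuot.mkAlgHom_rel k (ERel.vinv_v (q := q))

/-- The coalgebra `C` with basis `c_p`, `p ∈ ℤ`: Mathlib's coalgebra structure on `ℤ →₀ k` makes
all `c_p` group-like. -/
abbrev CZ (k : Type*) [Field k] : Type _ := ℤ →₀ k

/-- The basis element `c_p`. -/
def CZ.c (k : Type*) [Field k] (p : ℤ) : CZ k := Finsupp.single p 1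

/-- The linear map `Φ : C → E_q(2)` with `Φ (c_p) = v ^ (p - s)`. -/
def Phi (q : k) (s : ℤ) : CZ k →ₗ[k] E q :=
  Finsupp.linearCombination k fun p : ℤ => ((E.vUnit q ^ (p - s) : (E q)ˣ) : E q)

/-- The prescribed values of the entwining map on the generators of `E_q(2)`. -/
structure HasGenValues (q μ ν : k) (ψ : CZ k ⊗[k] E q →ₗ[k] E q ⊗[k] CZ k) : Prop where
  v : ∀ p : ℤ, ψ (CZ.c k p ⊗ₜ E.gen q .v) = E.gen q .v ⊗ₜ CZ.c k (p + 1)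
  vinv : ∀ p : ℤ, ψ (CZ.c k p ⊗ₜ E.gen q .vinv) = E.gen q .vinv ⊗ₜ CZ.c k (p - 1)
  n : ∀ p : ℤ, ψ (CZ.c k p ⊗ₜ E.gen q .n) =
    E.gen q .n ⊗ₜ CZ.c k p + (μ * q ^ (2 * p)) • (E.gen q .v ⊗ₜ CZ.c k p)
      - (μ * q ^ (2 * p)) • (E.gen q .v ⊗ₜ CZ.c k (p + 1))
  nbar : ∀ p : ℤ, ψ (CZ.c k p ⊗ₜ E.gen q .nbar) =
    E.gen q .nbar ⊗ₜ CZ.c k p + (ν * q ^ (2 * p)) • (E.gen q .vinv ⊗ₜ CZ.c k p)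
      - (ν * q ^ (2 * p)) • (E.gen q .vinv ⊗ₜ CZ.c k (p - 1))

end Euclidean

end CoalgCrossed

end

open CoalgCrossed

/-!
Put `z_p = v + μ⁻¹ q⁻²ᵖ n` and `z̄_p = v⁻¹ + ν⁻¹ q⁻²ᵖ n̄`. Each pair `(z_p, z̄_p)` satisfies the
relation of the quantum hyperboloid, `v z_{p+1} = z_p v`, `v z̄_{p+1} = z̄_p v`, and the prescribed
values of `ψ` say that `ψ (c_p ⊗ z_p) = z_p ⊗ c_p`, `ψ (c_p ⊗ z̄_p) = z̄_p ⊗ c_p` and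
`ψ (c_p ⊗ v) = v ⊗ c_{p+1}`. These identities define a right action of `E_q(2)` on the left module
`E_q(2) ⊗ C`, and a map `ψ` compatible with the product is the same thing as such an action. The
same formulas, with `v` replaced by `1` and `(z_p, z̄_p)` by `(z, z̄)`, define an action on
`X_q ⊗ C` which recovers `x ∈ X_q` from its image in `E_q(2)`, so that `X_q → M` is injective. It
is surjective because the products of its image with the powers of `v` span `E_q(2)`.

The crossed product is the case `P = E_q(2)` of a theorem on an arbitrary cleaving map `Φ : C → P`:
the map `x ⊗ c ↦ x * Φ c` is injective on `M ⊗ C` and turns `ρ̂ (c ⊗ u)` into `Φ c * u` and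
`σ̂ (b ⊗ c)` into `Φ b * Φ c`, so that each law of crossed product data, and the multiplicativity
of `x ⊗ c ↦ x * Φ c` itself, follows from associativity in `P`.
-/

noncomputable section

namespace CoalgCrossed

section FreeModule

variable {k C A N N' : Type*} [Field k] [AddCommGroup C] [Module k C] [Ring A] [Algebra k A]
  [AddCommGroup N] [Module k N] [Module A N] [IsScalarTower k A N]
  [AddCommGroup N'] [Module k N'] [Module A N'] [IsScalarTower k A N']

/-- The `A`-linear extension `A ⊗ C → N`, `a ⊗ c ↦ a • g c`, of a linear map `g` to an `A`-module:
`LinearMap.liftBaseChange` for a possibly noncommutative `A`. -/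
def freeLift (g : C →ₗ[k] N) : A ⊗[k] C →ₗ[A] N :=
  TensorProduct.AlgebraTensorModule.lift <|
    haveI : SMulCommClass k A N := IsScalarTower.to_smulCommClass
    LinearMap.toSpanSingleton A (C →ₗ[k] N) g

theorem freeLift_tmul (g : C →ₗ[k] N) (a : A) (c : C) : freeLift g (a ⊗ₜ[k] c) = a • g c := rfl

theorem freeLift_add (g h : C →ₗ[k] N) :
    freeLift (A := A) (g + h) = freeLift g + freeLift h := by
  ext
  simp [freeLift_tmul]

theorem freeLift_comp (L : N →ₗ[A] N') (g : C →ₗ[k] N) :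
    freeLift (L.restrictScalars k ∘ₗ g) = L ∘ₗ freeLift (A := A) g := by
  ext
  simp [freeLift_tmul]

theorem freeLift_comp_mk_one (g : C →ₗ[k] N) :
    (freeLift (A := A) g).restrictScalars k ∘ₗ TensorProduct.mk k A C 1 = g := by
  ext
  simp [freeLift_tmul]

theorem freeLift_mk_one : freeLift (TensorProduct.mk k A C 1) = LinearMap.id := by
  ext
  simp [freeLift_tmul]

theorem exists_freeLift_rTensor_subtype_eq {V : Submodule k A} {f : C →ₗ[k] A} {a : A}
    (ha : a ∈ V * LinearMap.range f) :
    ∃ t : V ⊗[k] C, freeLift f (V.subtype.rTensor C t) = a := by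
  induction ha using Submodule.mul_induction_on' with
  | mem_mul_mem x hx y hy =>
    obtain ⟨c, rfl⟩ := hy
    exact ⟨⟨x, hx⟩ ⊗ₜ c, rfl⟩
  | add a _ b _ ha hb =>
    obtain ⟨t, rfl⟩ := ha
    obtain ⟨t', rfl⟩ := hb
    exact ⟨t + t', by rw [map_add, map_add]⟩

end FreeModule

section CompatibleAlg

variable {k C C' P : Type*} [Field k] [AddCommGroup C] [Module k C] [AddCommGroup C'] [Module k C']
  [Ring P] [Algebra k P]

theorem lTensor_smul (L : C →ₗ[k] C') (x : P) (t : P ⊗[k] C) :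
    L.lTensor P (x • t) = x • L.lTensor P t :=
  map_smul (L.baseChange P) x t

theorem CompatibleAlg.apply_mul {ψ : C ⊗[k] P →ₗ[k] P ⊗[k] C} (h : CompatibleAlg ψ) (c : C)
    (u w : P) : ψ (c ⊗ₜ (u * w)) = mulExt ψ (ψ (c ⊗ₜ u) ⊗ₜ w) := by
  simpa using LinearMap.congr_fun h.mul (c ⊗ₜ[k] (u ⊗ₜ[k] w))

theorem CompatibleAlg.lTensor_comp_eq_of_adjoin_eq_top {ψ : C ⊗[k] P →ₗ[k] P ⊗[k] C}
    {ψ' : C' ⊗[k] P →ₗ[k] P ⊗[k] C'} (h : CompatibleAlg ψ) (h' : CompatibleAlg ψ')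
    {L : C →ₗ[k] C'} {S : Set P} (hS : Algebra.adjoin k S = ⊤)
    (hψ : ∀ x ∈ S, ∀ c, L.lTensor P (ψ (c ⊗ₜ x)) = ψ' (L c ⊗ₜ x)) :
    L.lTensor P ∘ₗ ψ = ψ' ∘ₗ L.rTensor P := by
  refine TensorProduct.ext' fun c u => ?_
  simp only [LinearMap.comp_apply, LinearMap.rTensor_tmul]
  have hu : u ∈ Algebra.adjoin k S := hS ▸ Algebra.mem_top
  induction hu using Algebra.adjoin_induction generalizing c with
  | mem x hx => exact hψ x hx c
  | algebraMap r => simp [Algebra.algebraMap_eq_smul_one, h.one, h'.one]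
  | add u w _ _ hu hw => simp only [TensorProduct.tmul_add, map_add, hu, hw]
  | mul u w _ _ hu hw =>
    rw [h.apply_mul, h'.apply_mul, ← hu]
    induction ψ (c ⊗ₜ u) with
    | zero => simp
    | tmul x d => rw [mulExt_tmul, LinearMap.lTensor_tmul, mulExt_tmul, lTensor_smul, hw]
    | add s t hs ht => simp only [TensorProduct.add_tmul, map_add, hs, ht]

/-- The map `C ⊗ P → P ⊗ C`, `c ⊗ u ↦ (1 ⊗ c) · u`, of a right action of `P` on the left `P`-module
`P ⊗ C`. Right actions are encoded as homomorphisms into the opposite endomorphism algebra. -/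
def entwiningOfAction (π : P →ₐ[k] (Module.End P (P ⊗[k] C))ᵐᵒᵖ) : C ⊗[k] P →ₗ[k] P ⊗[k] C :=
  TensorProduct.lift <| LinearMap.flip
    { toFun u := ((π u).unop.restrictScalars k) ∘ₗ TensorProduct.mk k P C 1
      map_add' _ _ := by ext; simp
      map_smul' _ _ := by ext; simp }

theorem entwiningOfAction_tmul (π : P →ₐ[k] (Module.End P (P ⊗[k] C))ᵐᵒᵖ) (c : C) (u : P) :
    entwiningOfAction π (c ⊗ₜ u) = (π u).unop (1 ⊗ₜ c) := rfl

theorem mulExt_entwiningOfAction (π : P →ₐ[k] (Module.End P (P ⊗[k] C))ᵐᵒᵖ) (t : P ⊗[k] C)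
    (u : P) : mulExt (entwiningOfAction π) (t ⊗ₜ u) = (π u).unop t := by
  induction t with
  | zero => simp
  | tmul x c =>
    rw [mulExt_tmul, entwiningOfAction_tmul, ← map_smul, TensorProduct.smul_tmul', smul_eq_mul,
      mul_one]
  | add s t hs ht => rw [TensorProduct.add_tmul, map_add, map_add, hs, ht]

theorem compatibleAlg_entwiningOfAction (π : P →ₐ[k] (Module.End P (P ⊗[k] C))ᵐᵒᵖ) :
    CompatibleAlg (entwiningOfAction π) where
  mul := by
    ext c u w
    simp [mulExt_entwiningOfAction, entwiningOfAction_tmul]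
  one c := by simp [entwiningOfAction_tmul]

end CompatibleAlg

section CompatibleCoalg

variable {k C C' P : Type*} [Field k] [AddCommGroup C] [Module k C] [AddCommGroup C'] [Module k C']
  [Ring P] [Algebra k P]

/-- The composite `C ⊗ C' ⊗ P → C ⊗ P ⊗ C' → P ⊗ C ⊗ C'` of two entwining maps. -/
def entwineTensor (ψ : C ⊗[k] P →ₗ[k] P ⊗[k] C) (ψ' : C' ⊗[k] P →ₗ[k] P ⊗[k] C') :
    (C ⊗[k] C') ⊗[k] P →ₗ[k] P ⊗[k] (C ⊗[k] C') :=
  (TensorProduct.assoc k P C C').toLinearMap ∘ₗ ψ.rTensor C' ∘ₗ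
    (TensorProduct.assoc k C P C').symm.toLinearMap ∘ₗ ψ'.lTensor C ∘ₗ
      (TensorProduct.assoc k C C' P).toLinearMap

theorem entwineTensor_tmul (ψ : C ⊗[k] P →ₗ[k] P ⊗[k] C) (ψ' : C' ⊗[k] P →ₗ[k] P ⊗[k] C')
    (c : C) (d : C') (u : P) : entwineTensor ψ ψ' ((c ⊗ₜ d) ⊗ₜ u) =
      TensorProduct.assoc k P C C'
        (ψ.rTensor C' ((TensorProduct.assoc k C P C').symm (c ⊗ₜ ψ' (d ⊗ₜ u)))) := rfl

theorem mulExt_entwineTensor (ψ : C ⊗[k] P →ₗ[k] P ⊗[k] C) (ψ' : C' ⊗[k] P →ₗ[k] P ⊗[k] C')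
    (t : P ⊗[k] C) (d : C') (u : P) :
    mulExt (entwineTensor ψ ψ') (TensorProduct.assoc k P C C' (t ⊗ₜ d) ⊗ₜ u) =
      TensorProduct.assoc k P C C' ((mulExt ψ).rTensor C'
        ((TensorProduct.assoc k (P ⊗[k] C) P C').symm (t ⊗ₜ ψ' (d ⊗ₜ u)))) := by
  induction t with
  | zero => simp
  | add s t hs ht => simp only [TensorProduct.add_tmul, map_add, hs, ht]
  | tmul x c =>
    rw [TensorProduct.assoc_tmul, mulExt_tmul, entwineTensor_tmul]
    induction ψ' (d ⊗ₜ u) with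
    | zero => simp
    | add s t hs ht => simp only [TensorProduct.tmul_add, map_add, smul_add, hs, ht]
    | tmul y e =>
      simp only [TensorProduct.assoc_symm_tmul, LinearMap.rTensor_tmul, mulExt_tmul]
      rw [← TensorProduct.smul_tmul']
      exact (map_smul (TensorProduct.AlgebraTensorModule.assoc k k P P C C') x _).symm

theorem compatibleAlg_entwineTensor {ψ : C ⊗[k] P →ₗ[k] P ⊗[k] C}
    {ψ' : C' ⊗[k] P →ₗ[k] P ⊗[k] C'} (h : CompatibleAlg ψ) (h' : CompatibleAlg ψ') :
    CompatibleAlg (entwineTensor ψ ψ') where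
  mul := by
    ext c d u w
    change entwineTensor ψ ψ' ((c ⊗ₜ d) ⊗ₜ (u * w)) =
      mulExt (entwineTensor ψ ψ')
        (entwineTensor ψ ψ' ((c ⊗ₜ d) ⊗ₜ u) ⊗ₜ w)
    rw [entwineTensor_tmul, entwineTensor_tmul, h'.apply_mul]
    induction ψ' (d ⊗ₜ u) with
    | zero => simp
    | add s t hs ht => simp only [TensorProduct.add_tmul, TensorProduct.tmul_add, map_add, hs, ht]
    | tmul x e =>
      rw [TensorProduct.assoc_symm_tmul, LinearMap.rTensor_tmul, mulExt_entwineTensor, mulExt_tmul]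
      induction ψ' (e ⊗ₜ w) with
      | zero => simp
      | add s t hs ht => simp only [smul_add, TensorProduct.tmul_add, map_add, hs, ht]
      | tmul y f => simp [TensorProduct.smul_tmul', h.apply_mul]
  one c := by
    induction c with
    | zero => simp
    | add s t hs ht => simp only [TensorProduct.add_tmul, map_add, TensorProduct.tmul_add, hs, ht]
    | tmul c d => simp [entwineTensor_tmul, h.one, h'.one]

theorem compatibleAlg_comm : CompatibleAlg (TensorProduct.comm k k P).toLinearMap where
  mul := by ext; simp [mulExt_tmul, TensorProduct.smul_tmul']
  one := by simp

theorem CompatibleAlg.compatibleCoalg_of_adjoin_eq_top [Coalgebra k C]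
    {ψ : C ⊗[k] P →ₗ[k] P ⊗[k] C} (h : CompatibleAlg ψ) {S : Set P} (hS : Algebra.adjoin k S = ⊤)
    (hcomul : ∀ x ∈ S, ∀ c, Coalgebra.comul.lTensor P (ψ (c ⊗ₜ x)) =
      entwineTensor ψ ψ (Coalgebra.comul c ⊗ₜ x))
    (hcounit : ∀ x ∈ S, ∀ c, Coalgebra.counit.lTensor P (ψ (c ⊗ₜ x)) =
      x ⊗ₜ Coalgebra.counit (R := k) c) :
    CompatibleCoalg ψ where
  comul := by
    rw [h.lTensor_comp_eq_of_adjoin_eq_top (compatibleAlg_entwineTensor h h) hS hcomul]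
    rfl
  counit := by
    rw [h.lTensor_comp_eq_of_adjoin_eq_top compatibleAlg_comm hS (by simpa using hcounit)]
    ext
    simp

theorem CompatibleAlg.compatibleCoalg_of_isGroupLikeElem [Coalgebra k C]
    {ψ : C ⊗[k] P →ₗ[k] P ⊗[k] C} (h : CompatibleAlg ψ) {S : Set P} (hS : Algebra.adjoin k S = ⊤)
    {G : Set C} (hG : ∀ g ∈ G, IsGroupLikeElem k g) (hspan : Submodule.span k G = ⊤)
    (hψ : ∀ x ∈ S, ∀ g ∈ G, x ∈ Submodule.span k {w | ∃ d ∈ G, ψ (g ⊗ₜ w) = w ⊗ₜ d}) :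
    CompatibleCoalg ψ := by
  have hmem (c : C) : c ∈ Submodule.span k G := hspan ▸ Submodule.mem_top
  refine h.compatibleCoalg_of_adjoin_eq_top hS (fun x hx c => ?_) fun x hx c => ?_
  · induction hmem c using Submodule.span_induction with
    | zero => simp
    | add c d _ _ hc hd => simp only [TensorProduct.add_tmul, map_add, hc, hd]
    | smul r c _ hc => simp only [← TensorProduct.smul_tmul', map_smul, hc]
    | mem g hg =>
      replace hx := hψ x hx g hg
      induction hx using Submodule.span_induction with
      | zero => simp
      | add x y _ _ hx hy => simp only [TensorProduct.tmul_add, map_add, hx, hy]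
      | smul r x _ hx => simp only [TensorProduct.tmul_smul, map_smul, hx]
      | mem w hw =>
        obtain ⟨d, hd, hw⟩ := hw
        simp [hw, (hG g hg).comul_eq_tmul_self, (hG d hd).comul_eq_tmul_self, entwineTensor_tmul]
  · induction hmem c using Submodule.span_induction with
    | zero => simp
    | add c d _ _ hc hd =>
      simp only [TensorProduct.add_tmul, TensorProduct.tmul_add, map_add, hc, hd]
    | smul r c _ hc =>
      simp only [← TensorProduct.smul_tmul', TensorProduct.tmul_smul, map_smul, hc]
    | mem g hg =>
      replace hx := hψ x hx g hg
      induction hx using Submodule.span_induction with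
      | zero => simp
      | add x y _ _ hx hy =>
        simp only [TensorProduct.tmul_add, TensorProduct.add_tmul, map_add, hx, hy]
      | smul r x _ hx =>
        simp only [TensorProduct.tmul_smul, ← TensorProduct.smul_tmul', map_smul, hx]
      | mem w hw =>
        obtain ⟨d, hd, hw⟩ := hw
        simp [hw, (hG g hg).counit_eq_one, (hG d hd).counit_eq_one]

end CompatibleCoalg

section ConvolutionAction

variable {k C P N N' : Type*} [Field k] [AddCommGroup C] [Module k C] [Coalgebra k C]
  [Ring P] [Algebra k P]
  [AddCommGroup N] [Module k N] [Module P N] [IsScalarTower k P N]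
  [AddCommGroup N'] [Module k N'] [Module P N'] [IsScalarTower k P N']

/-- The action `f ⋆ g : c ↦ f (c₁) • g (c₂)` of the convolution algebra `Hom (C, P)` on
`Hom (C, N)`, for a `P`-module `N`. -/
def convSMul (f : C →ₗ[k] P) (g : C →ₗ[k] N) : C →ₗ[k] N :=
  (freeLift g).restrictScalars k ∘ₗ f.rTensor C ∘ₗ Coalgebra.comul

theorem convSMul_apply (f : C →ₗ[k] P) (g : C →ₗ[k] N) (c : C) :
    convSMul f g c = freeLift g (f.rTensor C (Coalgebra.comul c)) := rfl

theorem convSMul_add (f : C →ₗ[k] P) (g h : C →ₗ[k] N) :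
    convSMul f (g + h) = convSMul f g + convSMul f h := by
  simp only [convSMul, freeLift_add, LinearMap.restrictScalars_add, LinearMap.add_comp]

theorem convSMul_zero (f : C →ₗ[k] P) : convSMul f (0 : C →ₗ[k] N) = 0 := by
  simpa using convSMul_add f (0 : C →ₗ[k] N) 0

theorem convSMul_comp (f : C →ₗ[k] P) (L : N →ₗ[P] N') (g : C →ₗ[k] N) :
    convSMul f (L.restrictScalars k ∘ₗ g) = L.restrictScalars k ∘ₗ convSMul f g := by
  rw [convSMul, freeLift_comp]
  rfl

theorem map_convSMul (f : C →ₗ[k] P) (L : N →ₗ[P] N') (g : C →ₗ[k] N) (c : C) :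
    L (convSMul f g c) = convSMul f (L.restrictScalars k ∘ₗ g) c := by
  rw [convSMul_comp]
  rfl

theorem convSMul_flip_mk_comp (f g : C →ₗ[k] P) (d : C) :
    convSMul f ((TensorProduct.mk k P C).flip d ∘ₗ g) =
      (TensorProduct.mk k P C).flip d ∘ₗ convSMul f g := by
  have hflip : (TensorProduct.mk k P C).flip d =
      (LinearMap.toSpanSingleton P (P ⊗[k] C) (1 ⊗ₜ d)).restrictScalars k := by
    ext
    simp [TensorProduct.smul_tmul']
  rw [hflip, convSMul_comp]

theorem ofConv_mul_eq_convSMul (f g : WithConv (C →ₗ[k] P)) :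
    (f * g).ofConv = convSMul f.ofConv g.ofConv := by
  ext c
  rw [convSMul_apply, LinearMap.convMul_def]
  simp only [LinearMap.comp_apply]
  induction Coalgebra.comul (R := k) c with
  | zero => simp
  | tmul x y => simp [freeLift_tmul]
  | add s t hs ht => simp only [map_add, hs, ht]

/-- Coassociativity: `f (c₁) • B (c₂ ⊗ c₃)` may be computed by first acting on the leg `c₂`. -/
theorem convSMul_comp_comul (f : C →ₗ[k] P) {B B' : C ⊗[k] C →ₗ[k] N}
    (h : ∀ x d, convSMul f (B ∘ₗ (TensorProduct.mk k C C).flip d) x = B' (x ⊗ₜ d)) :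
    convSMul f (B ∘ₗ Coalgebra.comul) = B' ∘ₗ Coalgebra.comul := by
  set T : C ⊗[k] (C ⊗[k] C) →ₗ[k] N := (freeLift B).restrictScalars k ∘ₗ f.rTensor (C ⊗[k] C)
    with hT
  have hB : (T ∘ₗ (TensorProduct.assoc k C C C).toLinearMap) ∘ₗ Coalgebra.comul.rTensor C = B' := by
    refine TensorProduct.ext' fun x d => ?_
    rw [← h x d, convSMul_apply]
    simp only [LinearMap.comp_apply, LinearMap.rTensor_tmul]
    induction Coalgebra.comul (R := k) x with
    | zero => simp
    | tmul y z => simp [hT, freeLift_tmul]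
    | add s t hs ht => simp only [TensorProduct.add_tmul, map_add, hs, ht]
  have hlTensor : convSMul f (B ∘ₗ Coalgebra.comul) =
      T ∘ₗ Coalgebra.comul.lTensor C ∘ₗ Coalgebra.comul := by
    ext c
    rw [convSMul_apply]
    simp only [LinearMap.comp_apply]
    induction Coalgebra.comul (R := k) c with
    | zero => simp
    | tmul y z => simp [hT, freeLift_tmul]
    | add s t hs ht => simp only [map_add, hs, ht]
  rw [hlTensor, ← Coalgebra.coassoc, ← hB]
  rfl

theorem mul_convSMul (f g : WithConv (C →ₗ[k] P)) (h : C →ₗ[k] N) :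
    convSMul (f * g).ofConv h = convSMul f.ofConv (convSMul g.ofConv h) := by
  have hassoc : ∀ x d, convSMul f.ofConv
      (((freeLift h).restrictScalars k ∘ₗ g.ofConv.rTensor C) ∘ₗ
        (TensorProduct.mk k C C).flip d) x =
      ((freeLift h).restrictScalars k ∘ₗ (f * g).ofConv.rTensor C) (x ⊗ₜ d) := fun x d => by
    rw [ofConv_mul_eq_convSMul]
    exact LinearMap.congr_fun
      (convSMul_comp f.ofConv (LinearMap.toSpanSingleton P N (h d)) g.ofConv) x
  exact (convSMul_comp_comul f.ofConv hassoc).symm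

theorem one_convSMul (h : C →ₗ[k] N) : convSMul (1 : WithConv (C →ₗ[k] P)).ofConv h = h := by
  ext c
  rw [convSMul_apply, LinearMap.convOne_def]
  simp [LinearMap.rTensor_comp, freeLift_tmul]

theorem convSMul_one (f : C →ₗ[k] P) : convSMul f (1 : WithConv (C →ₗ[k] P)).ofConv = f := by
  simpa using (ofConv_mul_eq_convSMul (WithConv.toConv f) 1).symm

theorem convSMul_inv_convSMul (Φ : (WithConv (C →ₗ[k] P))ˣ) (h : C →ₗ[k] N) :
    convSMul (Φ⁻¹).val.ofConv (convSMul Φ.val.ofConv h) = h := by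
  rw [← mul_convSMul, Φ.inv_mul, one_convSMul]

theorem convSMul_convSMul_inv (Φ : (WithConv (C →ₗ[k] P))ˣ) (h : C →ₗ[k] N) :
    convSMul Φ.val.ofConv (convSMul (Φ⁻¹).val.ofConv h) = h := by
  simpa using convSMul_inv_convSMul Φ⁻¹ h

end ConvolutionAction

section MulExt

variable {k C P Q : Type*} [Field k] [AddCommGroup C] [Module k C] [Ring P] [Algebra k P]
  [AddCommGroup Q] [Module k Q]

theorem mulExt_eq_freeLift (f : C ⊗[k] Q →ₗ[k] P ⊗[k] C) (t : P ⊗[k] C) (u : Q) :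
    mulExt f (t ⊗ₜ u) = freeLift (f ∘ₗ (TensorProduct.mk k C Q).flip u) t := by
  induction t with
  | zero => simp
  | tmul x c => simp [mulExt_tmul, freeLift_tmul]
  | add s t hs ht => rw [TensorProduct.add_tmul, map_add, map_add, hs, ht]

theorem freeLift_mulExt {f : C →ₗ[k] P} {g : Q →ₗ[k] P}
    {r : C ⊗[k] Q →ₗ[k] P ⊗[k] C} (h : ∀ c u, freeLift f (r (c ⊗ₜ u)) = f c * g u)
    (t : P ⊗[k] C) (u : Q) : freeLift f (mulExt r (t ⊗ₜ u)) = freeLift f t * g u := by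
  induction t with
  | zero => simp
  | add s t hs ht => simp only [TensorProduct.add_tmul, map_add, add_mul, hs, ht]
  | tmul x c => rw [mulExt_tmul, map_smul, h, freeLift_tmul, smul_mul_assoc]

end MulExt

section Hat

variable {k C P Q Q' : Type*} [Field k] [AddCommGroup C] [Module k C] [Coalgebra k C]
  [Ring P] [Algebra k P] [AddCommGroup Q] [Module k Q] [AddCommGroup Q'] [Module k Q']

theorem hat_comp_lTensor {φ : C ⊗[k] Q →ₗ[k] Q ⊗[k] C} {φ' : C ⊗[k] Q' →ₗ[k] Q' ⊗[k] C}
    {g : Q' →ₗ[k] Q} (h : φ ∘ₗ g.lTensor C = g.rTensor C ∘ₗ φ') (f : C ⊗[k] Q →ₗ[k] P) :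
    hat φ f ∘ₗ g.lTensor C = hat φ' (f ∘ₗ g.lTensor C) := by
  refine TensorProduct.ext' fun c u => ?_
  simp only [hat, LinearMap.comp_apply, LinearEquiv.coe_coe, LinearMap.lTensor_tmul,
    LinearMap.rTensor_tmul]
  induction Coalgebra.comul (R := k) c with
  | zero => simp
  | add s t hs ht => simp only [TensorProduct.add_tmul, map_add, hs, ht]
  | tmul x d =>
    have hd : φ (d ⊗ₜ g u) = g.rTensor C (φ' (d ⊗ₜ u)) := LinearMap.congr_fun h (d ⊗ₜ u)
    rw [TensorProduct.assoc_tmul, TensorProduct.assoc_tmul, LinearMap.lTensor_tmul,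
      LinearMap.lTensor_tmul, hd]
    induction φ' (d ⊗ₜ u) with
    | zero => simp
    | tmul y e => simp
    | add s t hs ht => simp only [TensorProduct.tmul_add, map_add, hs, ht]

theorem CompatibleCoalg.assoc_symm_comul {φ : C ⊗[k] Q →ₗ[k] Q ⊗[k] C} (hφ : CompatibleCoalg φ)
    (c : C) (u : Q) :
    (TensorProduct.assoc k Q C C).symm (Coalgebra.comul.lTensor Q (φ (c ⊗ₜ u))) =
      φ.rTensor C ((TensorProduct.assoc k C Q C).symm
        (φ.lTensor C (TensorProduct.assoc k C C Q (Coalgebra.comul c ⊗ₜ u)))) :=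
  (LinearEquiv.symm_apply_eq _).2 (LinearMap.congr_fun hφ.comul (c ⊗ₜ u))

theorem CompatibleCoalg.hat_comp_self {φ : C ⊗[k] Q →ₗ[k] Q ⊗[k] C} (hφ : CompatibleCoalg φ)
    (h : Q ⊗[k] C →ₗ[k] P) (c : C) (u : Q) :
    hat φ (h ∘ₗ φ) (c ⊗ₜ u) = h.rTensor C
      ((TensorProduct.assoc k Q C C).symm (Coalgebra.comul.lTensor Q (φ (c ⊗ₜ u)))) := by
  rw [hφ.assoc_symm_comul, hat, LinearMap.rTensor_comp]
  rfl

theorem hat_eq_convSMul_hat {f : C →ₗ[k] P} {ρ h : C ⊗[k] Q →ₗ[k] P}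
    (hρ : ∀ c u, ρ (c ⊗ₜ u) = convSMul f (h ∘ₗ (TensorProduct.mk k C Q).flip u) c)
    (φ : C ⊗[k] Q →ₗ[k] Q ⊗[k] C) (c : C) (u : Q) :
    hat φ ρ (c ⊗ₜ u) = convSMul f (hat φ h ∘ₗ (TensorProduct.mk k C Q).flip u) c := by
  let B (g : C ⊗[k] Q →ₗ[k] P) : C ⊗[k] C →ₗ[k] P ⊗[k] C :=
    g.rTensor C ∘ₗ (TensorProduct.assoc k C Q C).symm.toLinearMap ∘ₗ φ.lTensor C ∘ₗ
      (TensorProduct.assoc k C C Q).toLinearMap ∘ₗ (TensorProduct.mk k (C ⊗[k] C) Q).flip u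
  have hassoc (x : C) (w : Q ⊗[k] C) :
      convSMul f (h.rTensor C ∘ₗ (TensorProduct.assoc k C Q C).symm.toLinearMap ∘ₗ
        (TensorProduct.mk k C (Q ⊗[k] C)).flip w) x =
      ρ.rTensor C ((TensorProduct.assoc k C Q C).symm (x ⊗ₜ w)) := by
    induction w with
    | zero => simp [convSMul_zero]
    | add s t hs ht =>
      simp only [map_add, LinearMap.comp_add, convSMul_add, LinearMap.add_apply, hs, ht,
        TensorProduct.tmul_add]
    | tmul y e =>
      have htmul : h.rTensor C ∘ₗ (TensorProduct.assoc k C Q C).symm.toLinearMap ∘ₗ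
          (TensorProduct.mk k C (Q ⊗[k] C)).flip (y ⊗ₜ e) =
          (TensorProduct.mk k P C).flip e ∘ₗ h ∘ₗ (TensorProduct.mk k C Q).flip y := by
        ext z
        simp
      rw [htmul, convSMul_flip_mk_comp, TensorProduct.assoc_symm_tmul, LinearMap.rTensor_tmul, hρ]
      rfl
  exact (LinearMap.congr_fun (convSMul_comp_comul f (B := B h) (B' := B ρ)
    fun x d => hassoc x (φ (d ⊗ₜ u))) c).symm

end Hat

namespace EntwiningData

variable {k C P : Type*} [Field k] [AddCommGroup C] [Module k C] [Coalgebra k C]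
  [Ring P] [Algebra k P] {D : EntwiningData k C P}

section Covariant

variable {f : C →ₗ[k] P}

theorem IsCovariant.ψ_e (hf : D.IsCovariant f) (c : C) :
    D.ψ (D.e ⊗ₜ f c) = convSMul f (TensorProduct.mk k P C 1) c := by
  rw [convSMul_apply, freeLift_mk_one, LinearMap.id_apply, ← D.ψC_e]
  exact LinearMap.congr_fun hf (D.e ⊗ₜ c)

theorem IsCovariant.ψ_e_mul (hf : D.IsCovariant f) (c : C) (y : P) :
    D.ψ (D.e ⊗ₜ (f c * y)) = convSMul f (D.ψ ∘ₗ (TensorProduct.mk k C P).flip y) c := by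
  rw [ψ_mul, hf.ψ_e, mulExt_eq_freeLift, convSMul_apply, convSMul_apply, freeLift_mk_one,
    LinearMap.id_apply]

theorem IsCovariant.ψ_e_convSMul (hf : D.IsCovariant f) (g : C →ₗ[k] P) (c : C) :
    D.ψ (D.e ⊗ₜ convSMul f g c) = convSMul f ((D.ψ ∘ₗ g.lTensor C) ∘ₗ Coalgebra.comul) c := by
  rw [convSMul_comp_comul f (B' := (D.ψ ∘ₗ TensorProduct.mk k C P D.e) ∘ₗ
    (freeLift g).restrictScalars k ∘ₗ f.rTensor C) fun x d => ?_]
  · rfl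
  · exact (hf.ψ_e_mul x (g d)).symm

end Covariant

section Cleaving

/-- A convolution-invertible map `Φ : C → P` is a cleaving map for the entwining data when it is
covariant and sends the group-like `e` to `1`. -/
structure IsCleaving (D : EntwiningData k C P) (Φ : (WithConv (C →ₗ[k] P))ˣ) : Prop where
  covariant : D.IsCovariant Φ.val.ofConv
  map_e : Φ.val.ofConv D.e = 1

theorem cleftRho_tmul (D : EntwiningData k C P) (f g : C →ₗ[k] P) (c : C) (u : P) :
    D.cleftRho f g (c ⊗ₜ u) = convSMul f
      (((freeLift g).restrictScalars k ∘ₗ D.ψ) ∘ₗ (TensorProduct.mk k C P).flip u) c := by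
  have hmul : LinearMap.mul' k P ∘ₗ g.lTensor P = (freeLift g).restrictScalars k := by
    ext
    simp [freeLift_tmul]
  rw [cleftRho, ← LinearMap.comp_assoc D.ψ, hmul, convSMul_apply]
  simp only [LinearMap.comp_apply, LinearMap.rTensor_tmul]
  induction Coalgebra.comul (R := k) c with
  | zero => simp
  | tmul x y => simp [freeLift_tmul]
  | add s t hs ht => simp only [TensorProduct.add_tmul, map_add, hs, ht]

theorem IsCovariant.cleftSigma_eq {f : C →ₗ[k] P} (hf : D.IsCovariant f) (g : C →ₗ[k] P) :
    D.cleftSigma f g = D.cleftRho f g ∘ₗ f.lTensor C := by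
  have hψ : TensorProduct.map f g ∘ₗ D.ψC = g.lTensor P ∘ₗ D.ψ ∘ₗ f.lTensor C := by
    rw [show D.ψ ∘ₗ f.lTensor C = f.rTensor C ∘ₗ D.ψC from hf, ← LinearMap.comp_assoc,
      LinearMap.lTensor_comp_rTensor]
  rw [cleftSigma, cleftRho, hψ]
  refine TensorProduct.ext' fun b c => ?_
  simp only [LinearMap.comp_apply, LinearMap.rTensor_tmul, LinearMap.lTensor_tmul]
  induction Coalgebra.comul (R := k) b with
  | zero => simp
  | tmul x y => simp
  | add s t hs ht => simp only [TensorProduct.add_tmul, map_add, hs, ht]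

variable {Φ : (WithConv (C →ₗ[k] P))ˣ}

theorem convSMul_inv_apply (Φ : (WithConv (C →ₗ[k] P))ˣ) (c : C) :
    convSMul Φ.val.ofConv (Φ⁻¹).val.ofConv c = algebraMap k P (Coalgebra.counit (R := k) c) := by
  rw [← ofConv_mul_eq_convSMul, Φ.mul_inv]
  rfl

theorem IsCleaving.ψ_comp_inv (h : D.IsCleaving Φ) :
    (D.ψ ∘ₗ (Φ⁻¹).val.ofConv.lTensor C) ∘ₗ Coalgebra.comul =
      (TensorProduct.mk k P C).flip D.e ∘ₗ (Φ⁻¹).val.ofConv := by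
  suffices convSMul Φ.val.ofConv ((D.ψ ∘ₗ (Φ⁻¹).val.ofConv.lTensor C) ∘ₗ Coalgebra.comul) =
      convSMul Φ.val.ofConv ((TensorProduct.mk k P C).flip D.e ∘ₗ (Φ⁻¹).val.ofConv) by
    simpa only [convSMul_inv_convSMul] using congrArg (convSMul (Φ⁻¹).val.ofConv) this
  ext c
  rw [← h.covariant.ψ_e_convSMul, convSMul_flip_mk_comp, LinearMap.comp_apply,
    convSMul_inv_apply, Algebra.algebraMap_eq_smul_one, TensorProduct.tmul_smul, map_smul,
    D.ψ_alg.one]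
  simp [TensorProduct.smul_tmul']

theorem ψ_comp_freeLift (D : EntwiningData k C P) (g : C →ₗ[k] P) (u : P) :
    (D.ψ ∘ₗ (((freeLift g).restrictScalars k ∘ₗ D.ψ) ∘ₗ
        (TensorProduct.mk k C P).flip u).lTensor C) ∘ₗ Coalgebra.comul =
      (freeLift ((D.ψ ∘ₗ g.lTensor C) ∘ₗ Coalgebra.comul)).restrictScalars k ∘ₗ D.ψ ∘ₗ
        (TensorProduct.mk k C P).flip u := by
  have hcomul (t : C ⊗[k] C) :
      D.ψ ((((freeLift g).restrictScalars k ∘ₗ D.ψ) ∘ₗ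
          (TensorProduct.mk k C P).flip u).lTensor C t) =
        mulExt D.ψ (g.lTensor (P ⊗[k] C) (D.ψ.rTensor C ((TensorProduct.assoc k C P C).symm
          (D.ψ.lTensor C (TensorProduct.assoc k C C P (t ⊗ₜ u)))))) := by
    induction t with
    | zero => simp
    | add s t hs ht => simp only [TensorProduct.add_tmul, map_add, hs, ht]
    | tmul x d =>
      simp only [LinearMap.lTensor_tmul, LinearMap.comp_apply, LinearMap.flip_apply,
        TensorProduct.mk_apply, TensorProduct.assoc_tmul]
      induction D.ψ (d ⊗ₜ u) with
      | zero => simp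
      | add s t hs ht => simp only [TensorProduct.tmul_add, map_add, hs, ht]
      | tmul y e => simp [freeLift_tmul, ψ_mul]
  ext c
  simp only [LinearMap.comp_apply] at hcomul ⊢
  rw [hcomul, ← D.ψ_coalg.assoc_symm_comul, LinearMap.flip_apply, TensorProduct.mk_apply]
  induction D.ψ (c ⊗ₜ u) with
  | zero => simp
  | add s t hs ht => simp only [map_add, hs, ht]
  | tmul y d =>
    simp only [LinearMap.lTensor_tmul, LinearMap.restrictScalars_apply, freeLift_tmul,
      LinearMap.comp_apply]
    induction Coalgebra.comul (R := k) d with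
    | zero => simp
    | add s t hs ht => simp only [TensorProduct.tmul_add, map_add, smul_add, hs, ht]
    | tmul a b => simp [mulExt_tmul]

theorem IsCleaving.cleftRho_mem (h : D.IsCleaving Φ) (t : C ⊗[k] P) :
    D.cleftRho Φ.val.ofConv (Φ⁻¹).val.ofConv t ∈ D.M := by
  induction t with
  | zero => simp
  | add s t hs ht => rw [map_add]; exact add_mem hs ht
  | tmul c u =>
    change D.ψ (D.e ⊗ₜ _) = _ ⊗ₜ D.e
    have hflip :
        (freeLift ((TensorProduct.mk k P C).flip D.e ∘ₗ (Φ⁻¹).val.ofConv)).restrictScalars k =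
          (TensorProduct.mk k P C).flip D.e ∘ₗ
            (freeLift (A := P) (Φ⁻¹).val.ofConv).restrictScalars k := by
      ext
      simp [freeLift_tmul, TensorProduct.smul_tmul']
    rw [cleftRho_tmul, h.covariant.ψ_e_convSMul, ψ_comp_freeLift, h.ψ_comp_inv, hflip,
      LinearMap.comp_assoc, ← LinearMap.comp_assoc _ D.ψ, convSMul_flip_mk_comp]
    rfl

theorem rTensor_freeLift_assoc_symm_comul (f : C →ₗ[k] P) (t : P ⊗[k] C) :
    ((freeLift f).restrictScalars k).rTensor C
        ((TensorProduct.assoc k P C C).symm (Coalgebra.comul.lTensor P t)) =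
      freeLift (convSMul f (TensorProduct.mk k P C 1)) t := by
  induction t with
  | zero => simp
  | add s t hs ht => simp only [map_add, hs, ht]
  | tmul y d =>
    rw [LinearMap.lTensor_tmul, freeLift_tmul, convSMul_apply, freeLift_mk_one]
    induction Coalgebra.comul (R := k) d with
    | zero => simp
    | add s t hs ht =>
      simp only [TensorProduct.tmul_add, map_add, smul_add, hs, ht, LinearMap.id_apply]
    | tmul a b => simp [freeLift_tmul, TensorProduct.smul_tmul']

theorem rhoHat_cleftRho_tmul (D : EntwiningData k C P) (f g : C →ₗ[k] P) (c : C) (u : P) :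
    D.rhoHat (D.cleftRho f g) (c ⊗ₜ u) = convSMul f
      ((freeLift (convSMul g (TensorProduct.mk k P C 1))).restrictScalars k ∘ₗ D.ψ ∘ₗ
        (TensorProduct.mk k C P).flip u) c := by
  rw [rhoHat, hat_eq_convSMul_hat (cleftRho_tmul D f g)]
  congr 2
  ext d
  exact (D.ψ_coalg.hat_comp_self _ d u).trans (rTensor_freeLift_assoc_symm_comul g _)

theorem freeLift_rhoHat_cleftRho (D : EntwiningData k C P) (Φ : (WithConv (C →ₗ[k] P))ˣ) (c : C)
    (u : P) :
    freeLift Φ.val.ofConv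
        (D.rhoHat (D.cleftRho Φ.val.ofConv (Φ⁻¹).val.ofConv) (c ⊗ₜ u)) =
      Φ.val.ofConv c * u := by
  have hcounit : (freeLift (1 : WithConv (C →ₗ[k] P)).ofConv).restrictScalars k ∘ₗ D.ψ ∘ₗ
        (TensorProduct.mk k C P).flip u =
      (LinearMap.toSpanSingleton P P u).restrictScalars k ∘ₗ
        (1 : WithConv (C →ₗ[k] P)).ofConv := by
    ext d
    have hrid : (freeLift (A := P) (1 : WithConv (C →ₗ[k] P)).ofConv).restrictScalars k =
        (TensorProduct.rid k P).toLinearMap ∘ₗ Coalgebra.counit.lTensor P := by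
      ext
      simp [freeLift_tmul, LinearMap.convOne_def, Algebra.commutes, Algebra.smul_def]
    rw [hrid]
    simpa [LinearMap.convOne_def, Algebra.smul_def] using
      LinearMap.congr_fun D.ψ_coalg.counit (d ⊗ₜ u)
  rw [rhoHat_cleftRho_tmul, map_convSMul, ← LinearMap.comp_assoc,
    ← LinearMap.restrictScalars_comp, ← freeLift_comp, ← convSMul_comp, freeLift_comp_mk_one,
    ← ofConv_mul_eq_convSMul (Φ⁻¹).val Φ.val, Φ.inv_mul, hcounit, convSMul_comp, convSMul_one]
  rfl

/-- On `M ⊗ C` the map `u ↦ u₍₀₎ Φ⁻¹(u₍₁₎) ⊗ u₍₂₎`, with `u₍₀₎ ⊗ u₍₁₎ = ψ (e ⊗ u)`, inverts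
`x ⊗ c ↦ x * Φ c`. -/
theorem IsCovariant.freeLift_convSMul_ψ_e_freeLift (h : D.IsCovariant Φ.val.ofConv)
    (t : D.M ⊗[k] C) :
    freeLift (convSMul (Φ⁻¹).val.ofConv (TensorProduct.mk k P C 1))
      (D.ψ (D.e ⊗ₜ freeLift Φ.val.ofConv (D.incl t))) = D.incl t := by
  induction t with
  | zero => simp
  | add s t hs ht => simp only [map_add, TensorProduct.tmul_add, hs, ht]
  | tmul x c =>
    have hx : D.ψ (D.e ⊗ₜ (x : P)) = (x : P) ⊗ₜ D.e := x.2
    rw [incl_tmul, freeLift_tmul, smul_eq_mul, ψ_mul, hx, mulExt_tmul, h.ψ_e, map_smul,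
      map_convSMul, freeLift_comp_mk_one, convSMul_convSMul_inv]
    simp [TensorProduct.smul_tmul']

theorem IsCovariant.eq_of_freeLift_eq (h : D.IsCovariant Φ.val.ofConv) {t w : P ⊗[k] C}
    (ht : t ∈ LinearMap.range D.incl) (hw : w ∈ LinearMap.range D.incl)
    (htw : freeLift Φ.val.ofConv t = freeLift Φ.val.ofConv w) : t = w := by
  obtain ⟨t, rfl⟩ := ht
  obtain ⟨w, rfl⟩ := hw
  rw [← h.freeLift_convSMul_ψ_e_freeLift t, htw, h.freeLift_convSMul_ψ_e_freeLift]

theorem hat_mem_range_incl {Q : Type*} [AddCommGroup Q] [Module k Q] (φ : C ⊗[k] Q →ₗ[k] Q ⊗[k] C)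
    {f : C ⊗[k] Q →ₗ[k] P} (hf : ∀ t, f t ∈ D.M) (t : C ⊗[k] Q) :
    hat φ f t ∈ LinearMap.range D.incl := by
  have hcomp : f = D.M.val.toLinearMap ∘ₗ f.codRestrict (Subalgebra.toSubmodule D.M) hf := rfl
  rw [hcomp, hat, LinearMap.rTensor_comp]
  exact ⟨_, rfl⟩

theorem mulExt_mem_range_incl {Q : Type*} [AddCommGroup Q] [Module k Q]
    {r : C ⊗[k] Q →ₗ[k] P ⊗[k] C} (hr : ∀ c u, r (c ⊗ₜ u) ∈ LinearMap.range D.incl)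
    {t : P ⊗[k] C} (ht : t ∈ LinearMap.range D.incl) (u : Q) :
    mulExt r (t ⊗ₜ u) ∈ LinearMap.range D.incl := by
  obtain ⟨w, rfl⟩ := ht
  induction w with
  | zero => simp
  | tmul x c =>
    rw [incl_tmul, mulExt_tmul]
    exact smul_mem_range x.2 (hr c u)
  | add s t hs ht =>
    rw [map_add, TensorProduct.add_tmul, map_add]
    exact add_mem hs ht

theorem IsCleaving.cleftSigma_mem (h : D.IsCleaving Φ) (t : C ⊗[k] C) :
    D.cleftSigma Φ.val.ofConv (Φ⁻¹).val.ofConv t ∈ D.M := by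
  rw [h.covariant.cleftSigma_eq]
  exact h.cleftRho_mem _

/-- The map `σ : C ⊗ C → M` of the cleft extension defined by a cleaving map. -/
def IsCleaving.cocycle (h : D.IsCleaving Φ) : C ⊗[k] C →ₗ[k] D.M :=
  (D.cleftSigma Φ.val.ofConv (Φ⁻¹).val.ofConv).codRestrict (Subalgebra.toSubmodule D.M)
    h.cleftSigma_mem

theorem IsCleaving.val_comp_cocycle (h : D.IsCleaving Φ) :
    D.M.val.toLinearMap ∘ₗ h.cocycle = D.cleftSigma Φ.val.ofConv (Φ⁻¹).val.ofConv := rfl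

theorem IsCleaving.freeLift_sigmaHat (h : D.IsCleaving Φ) (b c : C) :
    freeLift Φ.val.ofConv (D.sigmaHat h.cocycle (b ⊗ₜ c)) = Φ.val.ofConv b * Φ.val.ofConv c := by
  rw [← freeLift_rhoHat_cleftRho D, sigmaHat, h.val_comp_cocycle, h.covariant.cleftSigma_eq,
    ← hat_comp_lTensor h.covariant]
  rfl

theorem IsCleaving.freeLift_mulFormula (h : D.IsCleaving Φ) (t w : P ⊗[k] C) :
    freeLift Φ.val.ofConv
        (D.mulFormula (D.cleftRho Φ.val.ofConv (Φ⁻¹).val.ofConv) h.cocycle (t ⊗ₜ w)) =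
      freeLift Φ.val.ofConv t * freeLift Φ.val.ofConv w := by
  induction w with
  | zero => simp
  | add v w hv hw => rw [TensorProduct.tmul_add, map_add, map_add, map_add, hv, hw, mul_add]
  | tmul x c =>
    rw [mulFormula_tmul, freeLift_mulExt h.freeLift_sigmaHat,
      freeLift_mulExt (g := LinearMap.id) (freeLift_rhoHat_cleftRho D Φ), freeLift_tmul,
      LinearMap.id_apply, smul_eq_mul, mul_assoc]

theorem IsCleaving.rhoHat_mem (h : D.IsCleaving Φ) (t : C ⊗[k] P) :
    D.rhoHat (D.cleftRho Φ.val.ofConv (Φ⁻¹).val.ofConv) t ∈ LinearMap.range D.incl :=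
  hat_mem_range_incl D.ψ h.cleftRho_mem t

theorem IsCleaving.mulFormula_mem (h : D.IsCleaving Φ) {t : P ⊗[k] C}
    (ht : t ∈ LinearMap.range D.incl) (w : P ⊗[k] C) :
    D.mulFormula (D.cleftRho Φ.val.ofConv (Φ⁻¹).val.ofConv) h.cocycle (t ⊗ₜ w) ∈
      LinearMap.range D.incl := by
  induction w with
  | zero => simp
  | add v w hv hw => rw [TensorProduct.tmul_add, map_add]; exact add_mem hv hw
  | tmul x c =>
    rw [mulFormula_tmul]
    exact mulExt_sigmaHat_mem (mulExt_mem_range_incl (fun b y => h.rhoHat_mem (b ⊗ₜ y)) ht x) c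

theorem IsCleaving.cleftRho_e (h : D.IsCleaving Φ) {x : P} (hx : x ∈ D.M) :
    D.cleftRho Φ.val.ofConv (Φ⁻¹).val.ofConv (D.e ⊗ₜ x) = x := by
  have hψ : D.ψ (D.e ⊗ₜ x) = x ⊗ₜ D.e := hx
  have hat_e : D.rhoHat (D.cleftRho Φ.val.ofConv (Φ⁻¹).val.ofConv) (D.e ⊗ₜ x) =
      D.cleftRho Φ.val.ofConv (Φ⁻¹).val.ofConv (D.e ⊗ₜ x) ⊗ₜ D.e := by
    simp [rhoHat, hat, D.e_groupLike.comul_eq_tmul_self, hψ]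
  simpa [hat_e, freeLift_tmul, h.map_e] using freeLift_rhoHat_cleftRho D Φ D.e x

theorem cleftRho_one (D : EntwiningData k C P) (Φ : (WithConv (C →ₗ[k] P))ˣ) (c : C) :
    D.cleftRho Φ.val.ofConv (Φ⁻¹).val.ofConv (c ⊗ₜ 1) =
      algebraMap k P (Coalgebra.counit (R := k) c) := by
  have hone : D.ψ ∘ₗ (TensorProduct.mk k C P).flip 1 = TensorProduct.mk k P C 1 :=
    LinearMap.ext D.ψ_alg.one
  rw [cleftRho_tmul, LinearMap.comp_assoc, hone, freeLift_comp_mk_one, convSMul_inv_apply]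

theorem IsCleaving.cocycle_e (h : D.IsCleaving Φ) (c : C) :
    h.cocycle (D.e ⊗ₜ c) = algebraMap k D.M (Coalgebra.counit (R := k) c) := by
  refine Subtype.ext ((LinearMap.congr_fun (h.covariant.cleftSigma_eq _) (D.e ⊗ₜ c)).trans ?_)
  rw [LinearMap.comp_apply, LinearMap.lTensor_tmul, cleftRho_tmul, convSMul_apply,
    D.e_groupLike.comul_eq_tmul_self, LinearMap.rTensor_tmul, freeLift_tmul, h.map_e, one_smul]
  change freeLift (Φ⁻¹).val.ofConv (D.ψ (D.e ⊗ₜ Φ.val.ofConv c)) = _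
  rw [h.covariant.ψ_e, map_convSMul, freeLift_comp_mk_one, convSMul_inv_apply]
  rfl

/-- Each law is an identity in `M ⊗ C`, on which `x ⊗ c ↦ x * Φ c` is injective; the images
under this map are products in `P`. -/
theorem IsCleaving.isCrossedProductData (h : D.IsCleaving Φ) :
    D.IsCrossedProductData (D.cleftRho Φ.val.ofConv (Φ⁻¹).val.ofConv) h.cocycle where
  rho_e _ hx := h.cleftRho_e hx
  rho_one c := cleftRho_one D Φ c
  rho_mem c x _ := h.rhoHat_mem (c ⊗ₜ x)
  rho_mul c x _ y _ := by
    refine h.covariant.eq_of_freeLift_eq (h.rhoHat_mem _)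
      (mulExt_mem_range_incl (fun b z => h.rhoHat_mem (b ⊗ₜ z)) (h.rhoHat_mem _) y) ?_
    rw [freeLift_mulExt (g := LinearMap.id) (freeLift_rhoHat_cleftRho D Φ),
      freeLift_rhoHat_cleftRho, freeLift_rhoHat_cleftRho, LinearMap.id_apply, mul_assoc]
  sigma_e c := h.cocycle_e c
  sigma_hat_e c := by
    refine h.covariant.eq_of_freeLift_eq (sigmaHat_mem c D.e) ⟨1 ⊗ₜ c, rfl⟩ ?_
    rw [h.freeLift_sigmaHat, h.map_e, freeLift_tmul, one_smul, mul_one]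
  cocycle a b c := by
    rw [← mulFormula_one_tmul]
    refine h.covariant.eq_of_freeLift_eq (h.mulFormula_mem ⟨1 ⊗ₜ a, rfl⟩ _)
      (mulExt_sigmaHat_mem (sigmaHat_mem a b) c) ?_
    rw [h.freeLift_mulFormula, freeLift_mulExt h.freeLift_sigmaHat, h.freeLift_sigmaHat,
      h.freeLift_sigmaHat, freeLift_tmul, one_smul, mul_assoc]
  twisted_module a b x _ := by
    rw [← mulFormula_one_tmul]
    refine h.covariant.eq_of_freeLift_eq (h.mulFormula_mem ⟨1 ⊗ₜ a, rfl⟩ _)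
      (mulExt_mem_range_incl (fun b z => h.rhoHat_mem (b ⊗ₜ z)) (sigmaHat_mem a b) x) ?_
    rw [h.freeLift_mulFormula, freeLift_mulExt (g := LinearMap.id) (freeLift_rhoHat_cleftRho D Φ),
      h.freeLift_sigmaHat, freeLift_rhoHat_cleftRho, freeLift_tmul, one_smul, LinearMap.id_apply,
      mul_assoc]

theorem IsCovariant.freeLift_comp_incl_injective (h : D.IsCovariant Φ.val.ofConv) :
    Function.Injective ((freeLift Φ.val.ofConv).restrictScalars k ∘ₗ D.incl) := fun t w htw =>
  D.incl_injective (h.eq_of_freeLift_eq ⟨t, rfl⟩ ⟨w, rfl⟩ htw)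

theorem IsCleaving.freeLift_comp_incl_surjective (h : D.IsCleaving Φ) :
    Function.Surjective ((freeLift Φ.val.ofConv).restrictScalars k ∘ₗ D.incl) := fun u => by
  obtain ⟨t, ht⟩ := h.rhoHat_mem (D.e ⊗ₜ u)
  refine ⟨t, ?_⟩
  rw [LinearMap.comp_apply, ht, LinearMap.restrictScalars_apply, freeLift_rhoHat_cleftRho, h.map_e,
    one_mul]

/-- The algebra isomorphism `x ⊗ c ↦ x * Φ c` from the crossed product defined by a cleaving map
`Φ` to `P`. -/
def IsCleaving.crossedProductEquiv (h : D.IsCleaving Φ) :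
    CrossedProduct h.isCrossedProductData ≃ₐ[k] P :=
  AlgEquiv.ofBijective
    (AlgHom.ofLinearMap (((freeLift Φ.val.ofConv).restrictScalars k ∘ₗ D.incl) ∘ₗ
        (CrossedProduct.of _).symm.toLinearMap)
      (by
        change (1 : P) * Φ.val.ofConv D.e = 1
        rw [h.map_e, one_mul])
      (fun x y => by
        obtain ⟨x, rfl⟩ := (CrossedProduct.of _).surjective x
        obtain ⟨y, rfl⟩ := (CrossedProduct.of _).surjective y
        simp only [CrossedProduct.of_mul_of, LinearMap.comp_apply, LinearEquiv.coe_coe,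
          LinearEquiv.symm_apply_apply, LinearMap.restrictScalars_apply]
        rw [incl_crossedMul, h.freeLift_mulFormula]))
    (Function.Bijective.comp
      ⟨h.covariant.freeLift_comp_incl_injective, h.freeLift_comp_incl_surjective⟩
      (CrossedProduct.of _).symm.bijective)

theorem IsCleaving.crossedProductEquiv_of (h : D.IsCleaving Φ) (x : D.M) (c : C) :
    h.crossedProductEquiv (CrossedProduct.of _ (x ⊗ₜ c)) = (x : P) * Φ.val.ofConv c := rfl

/-- A submodule `N` of `M` is all of `M` once `N * Φ(C) = P`: then `u ∈ M` is `∑ xᵢ * Φ cᵢ` with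
`xᵢ ∈ N`, so that `u ⊗ e = ∑ xᵢ ⊗ cᵢ` and `u = ∑ ε(cᵢ) xᵢ`. -/
theorem IsCleaving.M_le_of_mul_range_eq_top (h : D.IsCleaving Φ) {N : Submodule k P}
    (hN : N ≤ Subalgebra.toSubmodule D.M) (htop : N * LinearMap.range Φ.val.ofConv = ⊤) :
    Subalgebra.toSubmodule D.M ≤ N := by
  intro u hu
  obtain ⟨t, ht⟩ := exists_freeLift_rTensor_subtype_eq (a := u) (htop ▸ Submodule.mem_top)
  have ht_mem : N.subtype.rTensor C t ∈ LinearMap.range D.incl := by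
    refine ⟨(Submodule.inclusion hN).rTensor C t, ?_⟩
    rw [incl, ← LinearMap.comp_apply, ← LinearMap.rTensor_comp]
    rfl
  have hue : u ⊗ₜ D.e = N.subtype.rTensor C t := by
    refine h.covariant.eq_of_freeLift_eq ⟨⟨u, hu⟩ ⊗ₜ D.e, rfl⟩ ht_mem ?_
    rw [ht, freeLift_tmul, h.map_e, smul_eq_mul, mul_one]
  have hrid : (TensorProduct.rid k P).toLinearMap ∘ₗ Coalgebra.counit.lTensor P ∘ₗ
      N.subtype.rTensor C =
      N.subtype ∘ₗ (TensorProduct.rid k N).toLinearMap ∘ₗ Coalgebra.counit.lTensor N :=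
    TensorProduct.ext' fun x c => by simp
  have hu_eq : u = N.subtype (TensorProduct.rid k N (Coalgebra.counit.lTensor N t)) := by
    have hrid_t := LinearMap.congr_fun hrid t
    rw [LinearMap.comp_apply, LinearMap.comp_apply, ← hue] at hrid_t
    simpa [D.e_groupLike.counit_eq_one] using hrid_t
  exact hu_eq ▸ Subtype.prop _

end Cleaving

end EntwiningData

section Basis

variable {k : Type*} [Field k]

theorem CZ.hom_ext {N : Type*} [AddCommMonoid N] [Module k N] {f g : CZ k →ₗ[k] N}
    (h : ∀ p, f (CZ.c k p) = g (CZ.c k p)) : f = g := by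
  ext p
  exact h p

theorem CZ.tmul_hom_ext {N : Type*} [AddCommMonoid N] [Module k N]
    {f g : CZ k ⊗[k] CZ k →ₗ[k] N}
    (h : ∀ p r, f (CZ.c k p ⊗ₜ CZ.c k r) = g (CZ.c k p ⊗ₜ CZ.c k r)) : f = g := by
  ext p r
  exact h p r

theorem CZ.freeModule_hom_ext {A N : Type*} [Ring A] [Algebra k A] [AddCommGroup N] [Module k N]
    [Module A N] [IsScalarTower k A N] {f g : A ⊗[k] CZ k →ₗ[A] N}
    (h : ∀ p, f (1 ⊗ₜ CZ.c k p) = g (1 ⊗ₜ CZ.c k p)) : f = g := by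
  apply TensorProduct.AlgebraTensorModule.curry_injective
  ext p
  exact h p

theorem CZ.span_range_c : Submodule.span k (Set.range (CZ.c k)) = ⊤ := by
  have hspan := (Finsupp.basisSingleOne (R := k) (ι := ℤ)).span_eq
  rwa [Finsupp.coe_basisSingleOne] at hspan

theorem CZ.comul_c (p : ℤ) :
    Coalgebra.comul (R := k) (CZ.c k p) = CZ.c k p ⊗ₜ CZ.c k p := by
  simp [CZ.c]

theorem CZ.counit_c (p : ℤ) : Coalgebra.counit (R := k) (CZ.c k p) = 1 := by
  simp [CZ.c]

theorem CZ.linearCombination_c {N : Type*} [AddCommMonoid N] [Module k N] (f : ℤ → N) (p : ℤ) :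
    Finsupp.linearCombination k f (CZ.c k p) = f p := by
  simp [CZ.c]

end Basis

section Generators

variable {k : Type*} [Field k] {q : k}

theorem E.adjoin_gen : Algebra.adjoin k (Set.range (E.gen q)) = ⊤ := by
  have hrange : Set.range (E.gen q) =
      RingQuot.mkAlgHom k (ERel q) '' Set.range (FreeAlgebra.ι k) := Set.range_comp _ _
  rw [hrange, ← AlgHom.map_adjoin, FreeAlgebra.adjoin_range_ι, Algebra.map_top,
    AlgHom.range_eq_top]
  exact RingQuot.mkAlgHom_surjective k (ERel q)

theorem X.adjoin_gen : Algebra.adjoin k (Set.range (X.gen q)) = ⊤ := by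
  have hrange : Set.range (X.gen q) =
      RingQuot.mkAlgHom k (XRel q) '' Set.range (FreeAlgebra.ι k) := Set.range_comp _ _
  rw [hrange, ← AlgHom.map_adjoin, FreeAlgebra.adjoin_range_ι, Algebra.map_top,
    AlgHom.range_eq_top]
  exact RingQuot.mkAlgHom_surjective k (XRel q)

/-- The universal property of `E_q(2)`. -/
def E.lift {B : Type*} [Ring B] [Algebra k B] (f : EGen → B)
    (v_n : f .v * f .n = q ^ 2 • (f .n * f .v))
    (v_nbar : f .v * f .nbar = q ^ 2 • (f .nbar * f .v))
    (n_nbar : f .n * f .nbar = q ^ 2 • (f .nbar * f .n))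
    (v_vinv : f .v * f .vinv = 1) (vinv_v : f .vinv * f .v = 1) : E q →ₐ[k] B :=
  RingQuot.liftAlgHom k ⟨FreeAlgebra.lift k f, by
    rintro x y (_ | _ | _ | _ | _) <;> simpa⟩

theorem E.lift_gen {B : Type*} [Ring B] [Algebra k B] (f : EGen → B)
    (v_n : f .v * f .n = q ^ 2 • (f .n * f .v))
    (v_nbar : f .v * f .nbar = q ^ 2 • (f .nbar * f .v))
    (n_nbar : f .n * f .nbar = q ^ 2 • (f .nbar * f .n))
    (v_vinv : f .v * f .vinv = 1) (vinv_v : f .vinv * f .v = 1) (g : EGen) :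
    E.lift f v_n v_nbar n_nbar v_vinv vinv_v (E.gen q g) = f g := by
  simp [E.lift, E.gen]

/-- The universal property of `X_q`. -/
def X.lift {B : Type*} [Ring B] [Algebra k B] (f : XGen → B)
    (z_zbar : f .z * f .zbar = q ^ 2 • (f .zbar * f .z) + algebraMap k B (1 - q ^ 2)) :
    X q →ₐ[k] B :=
  RingQuot.liftAlgHom k ⟨FreeAlgebra.lift k f, by
    rintro x y (_ | _)
    simpa only [map_add, map_smul, map_mul, FreeAlgebra.lift_ι_apply, AlgHom.commutes]⟩

theorem X.lift_gen {B : Type*} [Ring B] [Algebra k B] (f : XGen → B)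
    (z_zbar : f .z * f .zbar = q ^ 2 • (f .zbar * f .z) + algebraMap k B (1 - q ^ 2)) (g : XGen) :
    X.lift f z_zbar (X.gen q g) = f g := by
  simp [X.lift, X.gen]

theorem X.z_mul_zbar : X.gen q .z * X.gen q .zbar =
    q ^ 2 • (X.gen q .zbar * X.gen q .z) + algebraMap k (X q) (1 - q ^ 2) := by
  simpa only [X.gen, map_add, map_smul, map_mul, AlgHom.commutes] using
    RingQuot.mkAlgHom_rel k (XRel.z_zbar (q := q))

theorem E.v_mul_n : E.gen q .v * E.gen q .n = q ^ 2 • (E.gen q .n * E.gen q .v) := by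
  simpa [E.gen] using RingQuot.mkAlgHom_rel k (ERel.v_n (q := q))

theorem E.v_mul_nbar : E.gen q .v * E.gen q .nbar = q ^ 2 • (E.gen q .nbar * E.gen q .v) := by
  simpa [E.gen] using RingQuot.mkAlgHom_rel k (ERel.v_nbar (q := q))

theorem E.n_mul_nbar : E.gen q .n * E.gen q .nbar = q ^ 2 • (E.gen q .nbar * E.gen q .n) := by
  simpa [E.gen] using RingQuot.mkAlgHom_rel k (ERel.n_nbar (q := q))

theorem E.v_mul_vinv : E.gen q .v * E.gen q .vinv = 1 := (E.vUnit q).mul_inv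

theorem E.vinv_mul_v : E.gen q .vinv * E.gen q .v = 1 := (E.vUnit q).inv_mul

theorem E.n_mul_vinv : E.gen q .n * E.gen q .vinv = q ^ 2 • (E.gen q .vinv * E.gen q .n) := by
  refine (E.vUnit q).isUnit.mul_left_cancel ?_
  change E.gen q .v * _ = E.gen q .v * _
  rw [← mul_assoc, E.v_mul_n, smul_mul_assoc, mul_assoc, E.v_mul_vinv, mul_one, mul_smul_comm,
    ← mul_assoc, E.v_mul_vinv, one_mul]

end Generators

section Frame

variable {k : Type*} [Field k] {q : k}

theorem zpow_two_mul_add_one (hq : q ≠ 0) (p : ℤ) : q ^ (2 * (p + 1)) = q ^ 2 * q ^ (2 * p) := by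
  rw [← zpow_natCast, ← zpow_add₀ hq]
  congr 1
  push_cast
  ring

theorem zpow_neg_two_mul_eq (hq : q ≠ 0) (p : ℤ) :
    q ^ (-2 * p) = q ^ 2 * q ^ (-2 * (p + 1)) := by
  rw [← zpow_natCast, ← zpow_add₀ hq]
  congr 1
  push_cast
  ring

theorem inv_mul_zpow_mul_cancel {μ : k} (hq : q ≠ 0) (hμ : μ ≠ 0) (p : ℤ) :
    μ⁻¹ * q ^ (-2 * p) * (μ * q ^ (2 * p)) = 1 := by
  rw [neg_mul, zpow_neg]
  field_simp

theorem semiconjBy_zpow {G : Type*} [Monoid G] {a : Gˣ} {w : ℤ → G}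
    (hw : ∀ p, SemiconjBy (a : G) (w (p + 1)) (w p)) (p m : ℤ) :
    SemiconjBy ((a ^ m : Gˣ) : G) (w (p + m)) (w p) := by
  induction m with
  | zero => simp
  | succ i ih =>
    rw [zpow_add_one, Units.val_mul, ← add_assoc]
    exact ih.mul_left (hw _)
  | pred i ih =>
    rw [zpow_sub_one, Units.val_mul]
    refine ih.mul_left (SemiconjBy.units_inv_symm_left ?_)
    have := hw (p + (-i - 1))
    rwa [add_assoc, sub_add_cancel] at this

/-- Hyperboloid pairs `(z_p, z̄_p)`, `p ∈ ℤ`, in an algebra `A`, with a unit `α` conjugating the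
`(p + 1)`-st to the `p`-th. They encode the right actions of `E_q(2)` on the free module `A ⊗ C`,
see `HyperboloidFrame.act`. -/
structure HyperboloidFrame (q : k) (A : Type*) [Ring A] [Algebra k A] where
  α : Aˣ
  z : ℤ → A
  zbar : ℤ → A
  semiconjBy_z : ∀ p, SemiconjBy (α : A) (z (p + 1)) (z p)
  semiconjBy_zbar : ∀ p, SemiconjBy (α : A) (zbar (p + 1)) (zbar p)
  z_mul_zbar : ∀ p, z p * zbar p = q ^ 2 • (zbar p * z p) + algebraMap k A (1 - q ^ 2)

/-- The frame `v`, `z_p = v + μ⁻¹ q⁻²ᵖ n`, `z̄_p = v⁻¹ + ν⁻¹ q⁻²ᵖ n̄` in `E_q(2)`. Here `z_p` and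
`z̄_p` are the combinations with `ψ (c_p ⊗ z_p) = z_p ⊗ c_p` and `ψ (c_p ⊗ z̄_p) = z̄_p ⊗ c_p`. -/
def euclideanFrame (μ ν : k) (hq : q ≠ 0) : HyperboloidFrame q (E q) where
  α := E.vUnit q
  z p := E.gen q .v + (μ⁻¹ * q ^ (-2 * p)) • E.gen q .n
  zbar p := E.gen q .vinv + (ν⁻¹ * q ^ (-2 * p)) • E.gen q .nbar
  semiconjBy_z p := by
    change E.gen q .v * _ = _ * E.gen q .v
    rw [zpow_neg_two_mul_eq hq p]
    simp only [mul_add, add_mul, mul_smul_comm, smul_mul_assoc, E.v_mul_n]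
    module
  semiconjBy_zbar p := by
    change E.gen q .v * _ = _ * E.gen q .v
    rw [zpow_neg_two_mul_eq hq p]
    simp only [mul_add, add_mul, mul_smul_comm, smul_mul_assoc, E.v_mul_nbar, E.v_mul_vinv,
      E.vinv_mul_v]
    module
  z_mul_zbar p := by
    simp only [mul_add, add_mul, mul_smul_comm, smul_mul_assoc, E.v_mul_nbar, E.v_mul_vinv,
      E.vinv_mul_v, E.n_mul_nbar, E.n_mul_vinv, Algebra.algebraMap_eq_smul_one]
    module

/-- The frame `α = 1`, `z_p = z`, `z̄_p = z̄` in `X_q`. -/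
def hyperboloidFrame (q : k) : HyperboloidFrame q (X q) where
  α := 1
  z _ := X.gen q .z
  zbar _ := X.gen q .zbar
  semiconjBy_z _ := SemiconjBy.one_left _
  semiconjBy_zbar _ := SemiconjBy.one_left _
  z_mul_zbar _ := X.z_mul_zbar

theorem E.gen_n_eq {μ : k} (ν : k) (hq : q ≠ 0) (hμ : μ ≠ 0) (p : ℤ) :
    E.gen q .n = (μ * q ^ (2 * p)) • ((euclideanFrame μ ν hq).z p - E.gen q .v) := by
  rw [euclideanFrame, add_sub_cancel_left, smul_smul, mul_comm, inv_mul_zpow_mul_cancel hq hμ,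
    one_smul]

theorem E.gen_nbar_eq (μ : k) {ν : k} (hq : q ≠ 0) (hν : ν ≠ 0) (p : ℤ) :
    E.gen q .nbar = (ν * q ^ (2 * p)) • ((euclideanFrame μ ν hq).zbar p - E.gen q .vinv) := by
  rw [euclideanFrame, add_sub_cancel_left, smul_smul, mul_comm, inv_mul_zpow_mul_cancel hq hν,
    one_smul]

namespace HyperboloidFrame

variable {A : Type*} [Ring A] [Algebra k A] (F : HyperboloidFrame q A)

/-- The homomorphism from the quantum hyperboloid with `z ↦ z_p` and `z̄ ↦ z̄_p`. -/
def hom (p : ℤ) : X q →ₐ[k] A :=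
  X.lift (fun | .z => F.z p | .zbar => F.zbar p) (F.z_mul_zbar p)

theorem hom_z (p : ℤ) : F.hom p (X.gen q .z) = F.z p := X.lift_gen ..

theorem hom_zbar (p : ℤ) : F.hom p (X.gen q .zbar) = F.zbar p := X.lift_gen ..

theorem hom_mem {p : ℤ} {S : Subalgebra k A} (hz : F.z p ∈ S) (hzbar : F.zbar p ∈ S) (x : X q) :
    F.hom p x ∈ S := by
  have hle : Algebra.adjoin k (Set.range (X.gen q)) ≤ S.comap (F.hom p) := by
    refine Algebra.adjoin_le ?_
    rintro _ ⟨_ | _, rfl⟩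
    · simpa [hom_z] using hz
    · simpa [hom_zbar] using hzbar
  exact hle (X.adjoin_gen (q := q) ▸ Algebra.mem_top)

variable (μ ν : k)

/-- The right action of a generator of `E_q(2)` on the basis element `c_p` of `A ⊗ C`. In terms of
`n = μ q²ᵖ (z_p - v)` and `n̄ = ν q²ᵖ (z̄_p - v⁻¹)`, it makes `v` act by `c_p ↦ α c_{p+1}` and
the `p`-th hyperboloid pair of `E_q(2)` by `c_p ↦ z_p c_p` and `c_p ↦ z̄_p c_p`. -/
def genAct : EGen → ℤ → A ⊗[k] CZ k
  | .v, p => (F.α : A) ⊗ₜ CZ.c k (p + 1)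
  | .vinv, p => ((F.α⁻¹ : Aˣ) : A) ⊗ₜ CZ.c k (p - 1)
  | .n, p => (μ * q ^ (2 * p)) • (F.z p ⊗ₜ CZ.c k p - (F.α : A) ⊗ₜ CZ.c k (p + 1))
  | .nbar, p =>
    (ν * q ^ (2 * p)) • (F.zbar p ⊗ₜ CZ.c k p - ((F.α⁻¹ : Aˣ) : A) ⊗ₜ CZ.c k (p - 1))

/-- The endomorphism of `A ⊗ C` by which a generator of `E_q(2)` acts. -/
def genEnd (g : EGen) : Module.End A (A ⊗[k] CZ k) :=
  freeLift (Finsupp.linearCombination k (F.genAct μ ν g))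

theorem genEnd_tmul (g : EGen) (a : A) (p : ℤ) :
    F.genEnd μ ν g (a ⊗ₜ CZ.c k p) = a • F.genAct μ ν g p := by
  rw [genEnd, freeLift_tmul, CZ.linearCombination_c]

theorem α_mul_z (p : ℤ) : (F.α : A) * F.z (p + 1) = F.z p * F.α := F.semiconjBy_z p

theorem α_mul_zbar (p : ℤ) : (F.α : A) * F.zbar (p + 1) = F.zbar p * F.α := F.semiconjBy_zbar p

theorem αinv_mul_z (p : ℤ) :
    ((F.α⁻¹ : Aˣ) : A) * F.z (p - 1) = F.z p * ((F.α⁻¹ : Aˣ) : A) := by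
  have := (F.semiconjBy_z (p - 1)).units_inv_symm_left
  rwa [sub_add_cancel] at this

variable {μ ν}

theorem genEnd_n_mul_genEnd_v (hq : q ≠ 0) :
    F.genEnd μ ν .n * F.genEnd μ ν .v = q ^ 2 • (F.genEnd μ ν .v * F.genEnd μ ν .n) :=
  CZ.freeModule_hom_ext fun p => by
    simp only [Module.End.mul_apply, LinearMap.smul_apply, genEnd_tmul, one_smul, genAct,
      smul_sub, map_sub, TensorProduct.smul_tmul', smul_eq_mul, smul_mul_assoc, mul_smul_comm,
      α_mul_z, zpow_two_mul_add_one hq, smul_smul, mul_left_comm]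

theorem genEnd_nbar_mul_genEnd_v (hq : q ≠ 0) :
    F.genEnd μ ν .nbar * F.genEnd μ ν .v = q ^ 2 • (F.genEnd μ ν .v * F.genEnd μ ν .nbar) :=
  CZ.freeModule_hom_ext fun p => by
    simp only [Module.End.mul_apply, LinearMap.smul_apply, genEnd_tmul, one_smul, genAct,
      smul_sub, map_sub, TensorProduct.smul_tmul', smul_eq_mul, smul_mul_assoc, mul_smul_comm,
      Units.mul_inv, Units.inv_mul, add_sub_cancel_right, sub_add_cancel, α_mul_zbar,
      zpow_two_mul_add_one hq, smul_smul, mul_left_comm]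

theorem genEnd_nbar_mul_genEnd_n (hq : q ≠ 0) :
    F.genEnd μ ν .nbar * F.genEnd μ ν .n = q ^ 2 • (F.genEnd μ ν .n * F.genEnd μ ν .nbar) :=
  CZ.freeModule_hom_ext fun p => by
    have hp : q ^ (2 * p) = q ^ 2 * q ^ (2 * (p - 1)) := by
      rw [← zpow_two_mul_add_one hq, sub_add_cancel]
    have hz : (F.z p * F.zbar p) ⊗ₜ[k] CZ.c k p =
        q ^ 2 • ((F.zbar p * F.z p) ⊗ₜ CZ.c k p) + (1 - q ^ 2) • (1 ⊗ₜ CZ.c k p) := by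
      rw [F.z_mul_zbar, Algebra.algebraMap_eq_smul_one, TensorProduct.add_tmul,
        TensorProduct.smul_tmul', TensorProduct.smul_tmul']
    simp only [Module.End.mul_apply, LinearMap.smul_apply, genEnd_tmul, one_smul, genAct,
      smul_sub, map_sub, TensorProduct.smul_tmul', smul_eq_mul, smul_mul_assoc, mul_smul_comm,
      Units.mul_inv, Units.inv_mul, add_sub_cancel_right, sub_add_cancel, α_mul_zbar,
      αinv_mul_z]
    simp only [← TensorProduct.smul_tmul', hz, zpow_two_mul_add_one hq p, hp]
    module

theorem genEnd_vinv_mul_genEnd_v : F.genEnd μ ν .vinv * F.genEnd μ ν .v = 1 :=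
  CZ.freeModule_hom_ext fun p => by
    simp [genEnd_tmul, genAct, TensorProduct.smul_tmul']

theorem genEnd_v_mul_genEnd_vinv : F.genEnd μ ν .v * F.genEnd μ ν .vinv = 1 :=
  CZ.freeModule_hom_ext fun p => by
    simp [genEnd_tmul, genAct, TensorProduct.smul_tmul']

/-- The right action of `E_q(2)` on `A ⊗ C` defined by a frame. -/
def act (μ ν : k) (hq : q ≠ 0) : E q →ₐ[k] (Module.End A (A ⊗[k] CZ k))ᵐᵒᵖ :=
  E.lift (fun g => MulOpposite.op (F.genEnd μ ν g))
    (MulOpposite.unop_injective (F.genEnd_n_mul_genEnd_v hq))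
    (MulOpposite.unop_injective (F.genEnd_nbar_mul_genEnd_v hq))
    (MulOpposite.unop_injective (F.genEnd_nbar_mul_genEnd_n hq))
    (MulOpposite.unop_injective F.genEnd_vinv_mul_genEnd_v)
    (MulOpposite.unop_injective F.genEnd_v_mul_genEnd_vinv)

theorem act_gen (hq : q ≠ 0) (g : EGen) (a : A) (p : ℤ) :
    (F.act μ ν hq (E.gen q g)).unop (a ⊗ₜ CZ.c k p) = a • F.genAct μ ν g p := by
  rw [act, E.lift_gen, MulOpposite.unop_op, genEnd_tmul]

theorem act_euclideanFrame_hom (hq : q ≠ 0) (hμ : μ ≠ 0) (hν : ν ≠ 0) (p : ℤ) (x : X q) :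
    (F.act μ ν hq ((euclideanFrame μ ν hq).hom p x)).unop (1 ⊗ₜ CZ.c k p) =
      F.hom p x ⊗ₜ CZ.c k p := by
  have hx : x ∈ Algebra.adjoin k (Set.range (X.gen q)) := X.adjoin_gen (q := q) ▸ Algebra.mem_top
  induction hx using Algebra.adjoin_induction with
  | mem x hx =>
    obtain ⟨_ | _, rfl⟩ := hx
    · simp only [hom_z, euclideanFrame, map_add, map_smul, MulOpposite.unop_add,
        MulOpposite.unop_smul, LinearMap.add_apply, LinearMap.smul_apply, act_gen, one_smul,
        genAct, smul_smul, inv_mul_zpow_mul_cancel hq hμ, add_sub_cancel]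
    · simp only [hom_zbar, euclideanFrame, map_add, map_smul, MulOpposite.unop_add,
        MulOpposite.unop_smul, LinearMap.add_apply, LinearMap.smul_apply, act_gen, one_smul,
        genAct, smul_smul, inv_mul_zpow_mul_cancel hq hν, add_sub_cancel]
  | algebraMap r => simp [Algebra.algebraMap_eq_smul_one, TensorProduct.smul_tmul']
  | add x y _ _ hx hy => simp only [map_add, MulOpposite.unop_add, LinearMap.add_apply, hx, hy,
      TensorProduct.add_tmul]
  | mul x y _ _ hx hy =>
    have hmul : F.hom p x ⊗ₜ[k] CZ.c k p = F.hom p x • (1 ⊗ₜ[k] CZ.c k p) := by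
      rw [TensorProduct.smul_tmul', smul_eq_mul, mul_one]
    rw [map_mul, map_mul, map_mul, MulOpposite.unop_mul, Module.End.mul_apply, hx, hmul, map_smul,
      hy, TensorProduct.smul_tmul', smul_eq_mul]

end HyperboloidFrame

theorem hyperboloidFrame_hom (p : ℤ) : (hyperboloidFrame q).hom p = AlgHom.id k (X q) := by
  refine AlgHom.ext_of_adjoin_eq_top X.adjoin_gen ?_
  rintro _ ⟨_ | _, rfl⟩
  · exact HyperboloidFrame.hom_z ..
  · exact HyperboloidFrame.hom_zbar ..

theorem euclideanFrame_hom_injective {μ ν : k} (hq : q ≠ 0) (hμ : μ ≠ 0) (hν : ν ≠ 0) (p : ℤ) :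
    Function.Injective ((euclideanFrame μ ν hq).hom p) := by
  refine Function.LeftInverse.injective (g := fun u =>
    TensorProduct.rid k (X q) (Coalgebra.counit.lTensor (X q)
      (((hyperboloidFrame q).act μ ν hq u).unop (1 ⊗ₜ CZ.c k p)))) fun x => ?_
  simp only [HyperboloidFrame.act_euclideanFrame_hom _ hq hμ hν, hyperboloidFrame_hom,
    AlgHom.id_apply, LinearMap.lTensor_tmul, CZ.counit_c, TensorProduct.rid_tmul, one_smul]

end Frame

section Euclidean

variable {k : Type*} [Field k] {q μ ν : k}

theorem hasGenValues_entwiningOfAction (hq : q ≠ 0) (hμ : μ ≠ 0) (hν : ν ≠ 0) :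
    HasGenValues q μ ν (entwiningOfAction ((euclideanFrame μ ν hq).act μ ν hq)) where
  v p := by
    rw [entwiningOfAction_tmul, HyperboloidFrame.act_gen, one_smul]
    rfl
  vinv p := by
    rw [entwiningOfAction_tmul, HyperboloidFrame.act_gen, one_smul]
    rfl
  n p := by
    rw [entwiningOfAction_tmul, HyperboloidFrame.act_gen, one_smul, E.gen_n_eq ν hq hμ p]
    simp only [HyperboloidFrame.genAct, TensorProduct.sub_tmul, ← TensorProduct.smul_tmul']
    rw [smul_sub, smul_sub, sub_add_cancel]
    rfl
  nbar p := by
    rw [entwiningOfAction_tmul, HyperboloidFrame.act_gen, one_smul, E.gen_nbar_eq μ hq hν p]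
    simp only [HyperboloidFrame.genAct, TensorProduct.sub_tmul, ← TensorProduct.smul_tmul']
    rw [smul_sub, smul_sub, sub_add_cancel]
    rfl

theorem HasGenValues.unique {ψ ψ' : CZ k ⊗[k] E q →ₗ[k] E q ⊗[k] CZ k}
    (h : HasGenValues q μ ν ψ) (h' : HasGenValues q μ ν ψ') (hψ : CompatibleAlg ψ)
    (hψ' : CompatibleAlg ψ') : ψ = ψ' := by
  have := hψ.lTensor_comp_eq_of_adjoin_eq_top hψ' (L := LinearMap.id) E.adjoin_gen ?_
  · simpa using this
  rintro _ ⟨g, rfl⟩ c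
  have hg : ψ ∘ₗ (TensorProduct.mk k (CZ k) (E q)).flip (E.gen q g) =
      ψ' ∘ₗ (TensorProduct.mk k (CZ k) (E q)).flip (E.gen q g) := by
    refine CZ.hom_ext fun p => ?_
    cases g <;> simp [h.v, h'.v, h.vinv, h'.vinv, h.n, h'.n, h.nbar, h'.nbar]
  simpa using LinearMap.congr_fun hg c

theorem HasGenValues.ψ_z {ψ : CZ k ⊗[k] E q →ₗ[k] E q ⊗[k] CZ k} (h : HasGenValues q μ ν ψ)
    (hq : q ≠ 0) (hμ : μ ≠ 0) (p : ℤ) :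
    ψ (CZ.c k p ⊗ₜ (euclideanFrame μ ν hq).z p) = (euclideanFrame μ ν hq).z p ⊗ₜ CZ.c k p := by
  simp only [euclideanFrame, TensorProduct.tmul_add, TensorProduct.tmul_smul, map_add, map_smul,
    h.v, h.n, TensorProduct.add_tmul, ← TensorProduct.smul_tmul', smul_add, smul_sub, smul_smul,
    inv_mul_zpow_mul_cancel hq hμ, one_smul]
  abel

theorem HasGenValues.ψ_zbar {ψ : CZ k ⊗[k] E q →ₗ[k] E q ⊗[k] CZ k} (h : HasGenValues q μ ν ψ)
    (hq : q ≠ 0) (hν : ν ≠ 0) (p : ℤ) :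
    ψ (CZ.c k p ⊗ₜ (euclideanFrame μ ν hq).zbar p) =
      (euclideanFrame μ ν hq).zbar p ⊗ₜ CZ.c k p := by
  simp only [euclideanFrame, TensorProduct.tmul_add, TensorProduct.tmul_smul, map_add, map_smul,
    h.vinv, h.nbar, TensorProduct.add_tmul, ← TensorProduct.smul_tmul', smul_add, smul_sub,
    smul_smul, inv_mul_zpow_mul_cancel hq hν, one_smul]
  abel

theorem HasGenValues.compatibleCoalg {ψ : CZ k ⊗[k] E q →ₗ[k] E q ⊗[k] CZ k}
    (h : HasGenValues q μ ν ψ) (hψ : CompatibleAlg ψ) (hq : q ≠ 0) (hμ : μ ≠ 0) (hν : ν ≠ 0) :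
    CompatibleCoalg ψ := by
  refine hψ.compatibleCoalg_of_isGroupLikeElem E.adjoin_gen (G := Set.range (CZ.c k))
    (Set.forall_mem_range.2 fun p => ⟨CZ.counit_c p, CZ.comul_c p⟩) CZ.span_range_c ?_
  rintro _ ⟨g, rfl⟩ _ ⟨p, rfl⟩
  have hmem {w : E q} (r : ℤ) (hw : ψ (CZ.c k p ⊗ₜ w) = w ⊗ₜ CZ.c k r) :
      w ∈ Submodule.span k {w | ∃ d ∈ Set.range (CZ.c k), ψ (CZ.c k p ⊗ₜ w) = w ⊗ₜ d} :=
    Submodule.subset_span ⟨_, ⟨r, rfl⟩, hw⟩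
  cases g with
  | v => exact hmem _ (h.v p)
  | vinv => exact hmem _ (h.vinv p)
  | n =>
    rw [E.gen_n_eq ν hq hμ p]
    exact Submodule.smul_mem _ _ (sub_mem (hmem _ (h.ψ_z hq hμ p)) (hmem _ (h.v p)))
  | nbar =>
    rw [E.gen_nbar_eq μ hq hν p]
    exact Submodule.smul_mem _ _ (sub_mem (hmem _ (h.ψ_zbar hq hν p)) (hmem _ (h.vinv p)))

/-- The linear map `c_p ⊗ c_r ↦ c_r ⊗ c_{p+r-s}`. -/
def psiC (k : Type*) [Field k] (s : ℤ) : CZ k ⊗[k] CZ k →ₗ[k] CZ k ⊗[k] CZ k :=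
  TensorProduct.lift (Finsupp.linearCombination k fun p : ℤ =>
    Finsupp.linearCombination k fun r : ℤ => CZ.c k r ⊗ₜ CZ.c k (p + r - s))

theorem psiC_tmul (s p r : ℤ) :
    psiC k s (CZ.c k p ⊗ₜ CZ.c k r) = CZ.c k r ⊗ₜ CZ.c k (p + r - s) := by
  rw [psiC, TensorProduct.lift.tmul, CZ.linearCombination_c, CZ.linearCombination_c]

theorem psiC_compatibleCoalg (s : ℤ) : CompatibleCoalg (psiC k s) where
  comul := CZ.tmul_hom_ext fun p r => by simp [psiC_tmul, CZ.comul_c]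
  counit := CZ.tmul_hom_ext fun p r => by simp [psiC_tmul, CZ.counit_c]

/-- The entwining data `(E_q(2), C, ψ, c_s, ψ^C)`. -/
def euclideanData (s : ℤ) (hq : q ≠ 0) (hμ : μ ≠ 0) (hν : ν ≠ 0) :
    EntwiningData k (CZ k) (E q) where
  ψ := entwiningOfAction ((euclideanFrame μ ν hq).act μ ν hq)
  ψ_alg := compatibleAlg_entwiningOfAction _
  ψ_coalg := (hasGenValues_entwiningOfAction hq hμ hν).compatibleCoalg
    (compatibleAlg_entwiningOfAction _) hq hμ hν
  e := CZ.c k s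
  e_groupLike := ⟨CZ.counit_c s, CZ.comul_c s⟩
  ψC := psiC k s
  ψC_coalg := psiC_compatibleCoalg s
  ψC_e := by
    refine LinearMap.congr_fun (f := psiC k s ∘ₗ TensorProduct.mk k _ _ (CZ.c k s))
      (CZ.hom_ext fun p => ?_)
    rw [CZ.comul_c, LinearMap.comp_apply, TensorProduct.mk_apply, psiC_tmul, add_sub_cancel_left]

theorem Phi_c (s p : ℤ) : Phi q s (CZ.c k p) = ((E.vUnit q ^ (p - s) : (E q)ˣ) : E q) :=
  CZ.linearCombination_c ..

/-- `Φ` as a unit of the convolution algebra, with inverse `c_p ↦ v ^ (s - p)`. -/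
def phiUnit (q : k) (s : ℤ) : (WithConv (CZ k →ₗ[k] E q))ˣ where
  val := WithConv.toConv (Phi q s)
  inv := WithConv.toConv (Finsupp.linearCombination k fun p : ℤ =>
    ((E.vUnit q ^ (s - p) : (E q)ˣ) : E q))
  val_inv := WithConv.ofConv_injective <| CZ.hom_ext fun p => by
    simp [LinearMap.convMul_def, LinearMap.convOne_def, CZ.comul_c, CZ.counit_c, Phi_c,
      CZ.linearCombination_c, ← Units.val_mul, ← zpow_add]
  inv_val := WithConv.ofConv_injective <| CZ.hom_ext fun p => by
    simp [LinearMap.convMul_def, LinearMap.convOne_def, CZ.comul_c, CZ.counit_c, Phi_c,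
      CZ.linearCombination_c, ← Units.val_mul, ← zpow_add]

theorem phiUnit_inv_c (s p : ℤ) :
    (phiUnit q s)⁻¹.val.ofConv (CZ.c k p) = ((E.vUnit q ^ (s - p) : (E q)ˣ) : E q) :=
  CZ.linearCombination_c ..

end Euclidean

section EuclideanCleaving

variable {k : Type*} [Field k] {q μ ν : k} {s : ℤ}

theorem HasGenValues.ψ_zpow {ψ : CZ k ⊗[k] E q →ₗ[k] E q ⊗[k] CZ k} (h : HasGenValues q μ ν ψ)
    (hψ : CompatibleAlg ψ) (p m : ℤ) :
    ψ (CZ.c k p ⊗ₜ ((E.vUnit q ^ m : (E q)ˣ) : E q)) =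
      ((E.vUnit q ^ m : (E q)ˣ) : E q) ⊗ₜ CZ.c k (p + m) := by
  induction m with
  | zero => simp [hψ.one]
  | succ i ih =>
    rw [zpow_add_one, Units.val_mul, hψ.apply_mul, ih, mulExt_tmul, ← add_assoc]
    exact (congrArg _ (h.v _)).trans (TensorProduct.smul_tmul' ..)
  | pred i ih =>
    rw [zpow_sub_one, Units.val_mul, hψ.apply_mul, ih, mulExt_tmul, ← add_sub_assoc]
    exact (congrArg _ (h.vinv _)).trans (TensorProduct.smul_tmul' ..)

theorem toSubmodule_mul_span_eq_top {P : Type*} [Ring P] [Algebra k P] {N : Subalgebra k P}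
    {S T : Set P} (hS : Algebra.adjoin k S = ⊤)
    (hone : 1 ∈ Subalgebra.toSubmodule N * Submodule.span k T)
    (hmul : ∀ x ∈ T, ∀ g ∈ S, x * g ∈ Subalgebra.toSubmodule N * Submodule.span k T) :
    Subalgebra.toSubmodule N * Submodule.span k T = ⊤ := by
  set W := Subalgebra.toSubmodule N * Submodule.span k T with hW
  have hspan {g : P} (hg : g ∈ S) : Submodule.span k T ≤ W.comap (LinearMap.mulRight k g) :=
    Submodule.span_le.2 fun x hx => hmul x hx g hg
  have hNW : Subalgebra.toSubmodule N * W = W := by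
    rw [hW, ← mul_assoc, N.isIdempotentElem_toSubmodule.eq]
  have hgen {g : P} (hg : g ∈ S) : W ≤ W.comap (LinearMap.mulRight k g) :=
    Submodule.mul_le.2 fun a ha x hx => by
      rw [Submodule.mem_comap, LinearMap.mulRight_apply, mul_assoc]
      exact hNW.le (Submodule.mul_mem_mul ha (hspan hg hx))
  have hright (u : P) : ∀ w ∈ W, w * u ∈ W := by
    have hu : u ∈ Algebra.adjoin k S := hS ▸ Algebra.mem_top
    induction hu using Algebra.adjoin_induction with
    | mem g hg => exact hgen hg
    | algebraMap r =>
      intro w hw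
      rw [← Algebra.commutes, ← Algebra.smul_def]
      exact W.smul_mem r hw
    | add u u' _ _ hu hu' => exact fun w hw => mul_add w u u' ▸ add_mem (hu w hw) (hu' w hw)
    | mul u u' _ _ hu hu' => exact fun w hw => mul_assoc w u u' ▸ hu' _ (hu w hw)
  exact eq_top_iff.2 fun u _ => one_mul u ▸ hright u 1 hone

theorem range_Phi (q : k) (s : ℤ) : LinearMap.range (Phi q s) =
    Submodule.span k (Set.range fun p : ℤ => ((E.vUnit q ^ (p - s) : (E q)ˣ) : E q)) :=
  Finsupp.range_linearCombination k

theorem range_hom_mul_range_Phi (hq : q ≠ 0) (hμ : μ ≠ 0) (hν : ν ≠ 0) (s : ℤ) :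
    Subalgebra.toSubmodule ((euclideanFrame μ ν hq).hom s).range * LinearMap.range (Phi q s) =
      ⊤ := by
  set F := euclideanFrame μ ν hq
  have hmem (x : X q) (p : ℤ) : F.hom s x * ((E.vUnit q ^ (p - s) : (E q)ˣ) : E q) ∈
      Subalgebra.toSubmodule (F.hom s).range * LinearMap.range (Phi q s) :=
    Submodule.mul_mem_mul ⟨x, rfl⟩ ⟨CZ.c k p, Phi_c s p⟩
  rw [range_Phi] at hmem ⊢
  have hpow := hmem 1
  simp only [map_one, one_mul] at hpow
  have hconj {w : ℤ → E q} (hw : ∀ p, SemiconjBy (E.vUnit q : E q) (w (p + 1)) (w p)) (p : ℤ) :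
      ((E.vUnit q ^ (p - s) : (E q)ˣ) : E q) * w p =
        w s * ((E.vUnit q ^ (p - s) : (E q)ˣ) : E q) := by
    simpa using (semiconjBy_zpow hw s (p - s)).eq
  have hv (p : ℤ) : ((E.vUnit q ^ (p - s) : (E q)ˣ) : E q) * E.gen q .v =
      ((E.vUnit q ^ (p + 1 - s) : (E q)ˣ) : E q) := by
    rw [add_sub_right_comm, zpow_add_one, Units.val_mul]
    rfl
  have hvinv (p : ℤ) : ((E.vUnit q ^ (p - s) : (E q)ˣ) : E q) * E.gen q .vinv =
      ((E.vUnit q ^ (p - 1 - s) : (E q)ˣ) : E q) := by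
    rw [sub_right_comm, zpow_sub_one, Units.val_mul]
    rfl
  refine toSubmodule_mul_span_eq_top E.adjoin_gen (by simpa using hpow s) ?_
  rintro _ ⟨p, rfl⟩ _ ⟨g, rfl⟩
  cases g with
  | v => exact hv p ▸ hpow (p + 1)
  | vinv => exact hvinv p ▸ hpow (p - 1)
  | n =>
    rw [E.gen_n_eq ν hq hμ p, mul_smul_comm, mul_sub, hv, hconj F.semiconjBy_z, ← F.hom_z]
    exact Submodule.smul_mem _ _ (sub_mem (hmem _ p) (hpow (p + 1)))
  | nbar =>
    rw [E.gen_nbar_eq μ hq hν p, mul_smul_comm, mul_sub, hvinv, hconj F.semiconjBy_zbar,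
      ← F.hom_zbar]
    exact Submodule.smul_mem _ _ (sub_mem (hmem _ p) (hpow (p - 1)))

/-- The entwining data `D` are those of the quantum Euclidean group, with parameters `μ, ν` and
group-like element `c_s`. -/
structure EntwiningData.IsEuclidean (q μ ν : k) (s : ℤ) (D : EntwiningData k (CZ k) (E q)) :
    Prop where
  hasGenValues : HasGenValues q μ ν D.ψ
  e_eq : D.e = CZ.c k s
  ψC_c : ∀ p r : ℤ, D.ψC (CZ.c k p ⊗ₜ CZ.c k r) = CZ.c k r ⊗ₜ CZ.c k (p + r - s)

theorem isEuclidean_euclideanData (s : ℤ) (hq : q ≠ 0) (hμ : μ ≠ 0) (hν : ν ≠ 0) :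
    (euclideanData s hq hμ hν).IsEuclidean q μ ν s where
  hasGenValues := hasGenValues_entwiningOfAction hq hμ hν
  e_eq := rfl
  ψC_c := psiC_tmul s

theorem cleftRho_phiUnit {D : EntwiningData k (CZ k) (E q)} {p r : ℤ} {u w : E q}
    (hu : D.ψ (CZ.c k p ⊗ₜ u) = w ⊗ₜ CZ.c k r) :
    D.cleftRho (phiUnit q s).val.ofConv (phiUnit q s)⁻¹.val.ofConv (CZ.c k p ⊗ₜ u) =
      ((E.vUnit q ^ (p - s) : (E q)ˣ) : E q) * (w * ((E.vUnit q ^ (s - r) : (E q)ˣ) : E q)) := by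
  rw [EntwiningData.cleftRho_tmul, convSMul_apply, CZ.comul_c, LinearMap.rTensor_tmul,
    freeLift_tmul]
  simp only [LinearMap.comp_apply, LinearMap.flip_apply, TensorProduct.mk_apply, hu,
    LinearMap.restrictScalars_apply, freeLift_tmul, phiUnit_inv_c, smul_eq_mul]
  exact congrArg (· * _) (Phi_c s p)

theorem cleftRho_phiUnit_of_semiconjBy {D : EntwiningData k (CZ k) (E q)} {w : ℤ → E q}
    (hw : ∀ p, SemiconjBy (E.vUnit q : E q) (w (p + 1)) (w p))
    (hψ : ∀ p, D.ψ (CZ.c k p ⊗ₜ w p) = w p ⊗ₜ CZ.c k p) (p : ℤ) :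
    D.cleftRho (phiUnit q s).val.ofConv (phiUnit q s)⁻¹.val.ofConv (CZ.c k p ⊗ₜ w p) = w s := by
  have hs := (semiconjBy_zpow hw s (p - s)).eq
  rw [add_sub_cancel] at hs
  rw [cleftRho_phiUnit (hψ p), ← mul_assoc, hs, mul_assoc, ← Units.val_mul, ← zpow_add]
  simp

namespace EntwiningData.IsEuclidean

variable {D : EntwiningData k (CZ k) (E q)} (hD : D.IsEuclidean q μ ν s)
include hD

theorem isCleaving_phiUnit : D.IsCleaving (phiUnit q s) where
  covariant := CZ.tmul_hom_ext fun p r => by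
    have hΦ : (phiUnit q s).val.ofConv (CZ.c k r) = _ := Phi_c s r
    simp only [LinearMap.comp_apply, LinearMap.lTensor_tmul, hD.ψC_c, LinearMap.rTensor_tmul, hΦ,
      hD.hasGenValues.ψ_zpow D.ψ_alg, add_sub_assoc]
  map_e := by
    rw [hD.e_eq]
    exact (Phi_c s s).trans (by simp)

theorem cleftRho_v (p : ℤ) : D.cleftRho (phiUnit q s).val.ofConv (phiUnit q s)⁻¹.val.ofConv
    (CZ.c k p ⊗ₜ E.gen q .v) = 1 := by
  rw [cleftRho_phiUnit (hD.hasGenValues.v p)]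
  change ((E.vUnit q ^ (p - s) * (E.vUnit q * E.vUnit q ^ (s - (p + 1))) : (E q)ˣ) : E q) = 1
  rw [← zpow_one_add, ← zpow_add, show p - s + (1 + (s - (p + 1))) = 0 by ring, zpow_zero]
  rfl

theorem cleftRho_vinv (p : ℤ) : D.cleftRho (phiUnit q s).val.ofConv (phiUnit q s)⁻¹.val.ofConv
    (CZ.c k p ⊗ₜ E.gen q .vinv) = 1 := by
  rw [cleftRho_phiUnit (hD.hasGenValues.vinv p)]
  change ((E.vUnit q ^ (p - s) * ((E.vUnit q)⁻¹ * E.vUnit q ^ (s - (p - 1))) : (E q)ˣ) : E q) = 1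
  rw [← zpow_neg_one, ← zpow_add, ← zpow_add, show p - s + (-1 + (s - (p - 1))) = 0 by ring,
    zpow_zero]
  rfl

theorem cleftRho_n (hq : q ≠ 0) (hμ : μ ≠ 0) (p : ℤ) :
    D.cleftRho (phiUnit q s).val.ofConv (phiUnit q s)⁻¹.val.ofConv (CZ.c k p ⊗ₜ E.gen q .n) =
      q ^ (2 * p) • (q ^ (-2 * s) • E.gen q .n + μ • (E.gen q .v - 1)) := by
  set F := euclideanFrame μ ν hq with hF
  rw [congrArg (CZ.c k p ⊗ₜ[k] ·) (E.gen_n_eq ν hq hμ p), TensorProduct.tmul_smul,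
    TensorProduct.tmul_sub, map_smul, map_sub, hD.cleftRho_v,
    cleftRho_phiUnit_of_semiconjBy F.semiconjBy_z (hD.hasGenValues.ψ_z hq hμ), hF, euclideanFrame]
  match_scalars <;> field_simp

theorem cleftRho_nbar (hq : q ≠ 0) (hν : ν ≠ 0) (p : ℤ) :
    D.cleftRho (phiUnit q s).val.ofConv (phiUnit q s)⁻¹.val.ofConv (CZ.c k p ⊗ₜ E.gen q .nbar) =
      q ^ (2 * p) • (q ^ (-2 * s) • E.gen q .nbar + ν • (E.gen q .vinv - 1)) := by
  set F := euclideanFrame μ ν hq with hF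
  rw [congrArg (CZ.c k p ⊗ₜ[k] ·) (E.gen_nbar_eq μ hq hν p), TensorProduct.tmul_smul,
    TensorProduct.tmul_sub, map_smul, map_sub, hD.cleftRho_vinv,
    cleftRho_phiUnit_of_semiconjBy F.semiconjBy_zbar (hD.hasGenValues.ψ_zbar hq hν), hF,
    euclideanFrame]
  match_scalars <;> field_simp

theorem cocycle_c (p r : ℤ) : hD.isCleaving_phiUnit.cocycle (CZ.c k p ⊗ₜ CZ.c k r) = 1 := by
  have hΦ : (phiUnit q s).val.ofConv (CZ.c k r) = _ := Phi_c s r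
  refine Subtype.ext ((LinearMap.congr_fun
    (hD.isCleaving_phiUnit.covariant.cleftSigma_eq _) (CZ.c k p ⊗ₜ CZ.c k r)).trans ?_)
  rw [LinearMap.comp_apply, LinearMap.lTensor_tmul, hΦ,
    cleftRho_phiUnit (hD.hasGenValues.ψ_zpow D.ψ_alg p (r - s)), ← Units.val_mul, ← Units.val_mul,
    ← zpow_add, ← zpow_add, show p - s + (r - s + (s - (p + (r - s)))) = 0 by ring, zpow_zero]
  rfl

theorem hom_mem_M (hq : q ≠ 0) (hμ : μ ≠ 0) (hν : ν ≠ 0) (x : X q) :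
    (euclideanFrame μ ν hq).hom s x ∈ D.M := by
  refine HyperboloidFrame.hom_mem _ ?_ ?_ x <;> change D.ψ (D.e ⊗ₜ _) = _ ⊗ₜ D.e <;> rw [hD.e_eq]
  · exact hD.hasGenValues.ψ_z hq hμ s
  · exact hD.hasGenValues.ψ_zbar hq hν s

/-- The isomorphism of the quantum hyperboloid with the fixed point subalgebra `M`, given by
`z ↦ v + μ⁻¹ q⁻²ˢ n` and `z̄ ↦ v⁻¹ + ν⁻¹ q⁻²ˢ n̄`. -/
def hyperboloidEquiv (hq : q ≠ 0) (hμ : μ ≠ 0) (hν : ν ≠ 0) : X q ≃ₐ[k] D.M :=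
  AlgEquiv.ofBijective
    (((euclideanFrame μ ν hq).hom s).codRestrict D.M (hD.hom_mem_M hq hμ hν))
    ⟨fun _ _ hxy => euclideanFrame_hom_injective hq hμ hν s (congrArg Subtype.val hxy),
      fun ⟨u, hu⟩ => by
        have hrange : Subalgebra.toSubmodule ((euclideanFrame μ ν hq).hom s).range ≤
            Subalgebra.toSubmodule D.M := by
          rintro _ ⟨x, rfl⟩
          exact hD.hom_mem_M hq hμ hν x
        obtain ⟨x, hx⟩ := hD.isCleaving_phiUnit.M_le_of_mul_range_eq_top hrange
          (range_hom_mul_range_Phi hq hμ hν s) hu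
        exact ⟨x, Subtype.ext hx⟩⟩

theorem hyperboloidEquiv_z (hq : q ≠ 0) (hμ : μ ≠ 0) (hν : ν ≠ 0) :
    (hD.hyperboloidEquiv hq hμ hν (X.gen q .z) : E q) =
      E.gen q .v + (μ⁻¹ * q ^ (-2 * s)) • E.gen q .n :=
  HyperboloidFrame.hom_z ..

theorem hyperboloidEquiv_zbar (hq : q ≠ 0) (hμ : μ ≠ 0) (hν : ν ≠ 0) :
    (hD.hyperboloidEquiv hq hμ hν (X.gen q .zbar) : E q) =
      E.gen q .vinv + (ν⁻¹ * q ^ (-2 * s)) • E.gen q .nbar :=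
  HyperboloidFrame.hom_zbar ..

end EntwiningData.IsEuclidean

end EuclideanCleaving

end CoalgCrossed

end

theorem mainTheorem6 {k : Type*} [Field k] (q μ ν : k) (hq : q ≠ 0) (hμ : μ ≠ 0) (hν : ν ≠ 0)
    (s : ℤ) :
    -- the values on the generators extend uniquely to a map compatible with the product
    (∃! ψ : CZ k ⊗[k] E q →ₗ[k] E q ⊗[k] CZ k, CompatibleAlg ψ ∧ HasGenValues q μ ν ψ) ∧
    -- the entwining data `(E_q(2), C, ψ, c_s, ψ^C)`
    ∃ D : EntwiningData k (CZ k) (E q),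
      HasGenValues q μ ν D.ψ ∧
      D.e = CZ.c k s ∧
      (∀ p r : ℤ, D.ψC (CZ.c k p ⊗ₜ CZ.c k r) = CZ.c k r ⊗ₜ CZ.c k (p + r - s)) ∧
      -- the fixed point subalgebra is the quantum hyperboloid
      ∃ ι : X q ≃ₐ[k] D.M,
        ((ι (X.gen q .z) : D.M) : E q) = E.gen q .v + (μ⁻¹ * q ^ (-2 * s)) • E.gen q .n ∧
        ((ι (X.gen q .zbar) : D.M) : E q) =
          E.gen q .vinv + (ν⁻¹ * q ^ (-2 * s)) • E.gen q .nbar ∧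
        -- `Φ` is unital, covariant and convolution invertible
        Phi q s D.e = 1 ∧
        D.IsCovariant (Phi q s) ∧
        ∃ Φ : (WithConv (CZ k →ₗ[k] E q))ˣ,
          (Φ : WithConv (CZ k →ₗ[k] E q)) = WithConv.toConv (Phi q s) ∧
          -- the cleft extension data defined by `Φ`: explicit `ρ` and trivial `σ`
          ∃ (ρ : CZ k ⊗[k] E q →ₗ[k] E q) (σ : CZ k ⊗[k] CZ k →ₗ[k] D.M),
            ρ = D.cleftRho (Phi q s) (Φ⁻¹).val.ofConv ∧
            D.M.val.toLinearMap ∘ₗ σ = D.cleftSigma (Phi q s) (Φ⁻¹).val.ofConv ∧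
            (∀ p r : ℤ, σ (CZ.c k p ⊗ₜ CZ.c k r) = 1) ∧
            (∀ p : ℤ, ρ (CZ.c k p ⊗ₜ E.gen q .v) = 1) ∧
            (∀ p : ℤ, ρ (CZ.c k p ⊗ₜ E.gen q .vinv) = 1) ∧
            (∀ p : ℤ, ρ (CZ.c k p ⊗ₜ E.gen q .n) =
              q ^ (2 * p) • (q ^ (-2 * s) • E.gen q .n + μ • (E.gen q .v - 1))) ∧
            (∀ p : ℤ, ρ (CZ.c k p ⊗ₜ E.gen q .nbar) =
              q ^ (2 * p) • (q ^ (-2 * s) • E.gen q .nbar + ν • (E.gen q .vinv - 1))) ∧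
            -- the crossed product exists and is isomorphic to `E_q(2)` as an algebra
            ∃ (h : D.IsCrossedProductData ρ σ)
              (Θ : EntwiningData.CrossedProduct h ≃ₐ[k] E q),
              ∀ (x : X q) (c : CZ k),
                Θ (EntwiningData.CrossedProduct.of h (ι x ⊗ₜ c)) = (ι x : E q) * Phi q s c := by
  have hD := isEuclidean_euclideanData s hq hμ hν
  have hΦ := hD.isCleaving_phiUnit
  exact ⟨⟨_, ⟨EntwiningData.ψ_alg _, hD.hasGenValues⟩, fun ψ hψ =>
      hψ.2.unique hD.hasGenValues hψ.1 (EntwiningData.ψ_alg _)⟩,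
    euclideanData s hq hμ hν, hD.hasGenValues, hD.e_eq, hD.ψC_c,
    hD.hyperboloidEquiv hq hμ hν, hD.hyperboloidEquiv_z hq hμ hν,
    hD.hyperboloidEquiv_zbar hq hμ hν,
    hΦ.map_e, hΦ.covariant, phiUnit q s, rfl,
    _, hΦ.cocycle, rfl, hΦ.val_comp_cocycle, hD.cocycle_c,
    hD.cleftRho_v, hD.cleftRho_vinv, hD.cleftRho_n hq hμ, hD.cleftRho_nbar hq hν,
    hΦ.isCrossedProductData, hΦ.crossedProductEquiv, fun x => hΦ.crossedProductEquiv_of _⟩
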